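/- Fix $\gamma>1$, $a\ge 0$, $C_v>0$. For a gas state with density $\rho>0$, velocity $(u,v)$ and specific internal energy $e>0$ put $T=e/C_v$, $p=(\gamma-1)\rho e$, $p_{tot}=p+\tfrac13 aT^4$, $e_{tot}=e+a\rho^{-1}T^4$, $E=\tfrac12\rho(u^2+v^2)+\rho e_{tot}$, and let $c=\sqrt{p/\rho+\hat K^2/(\rho e\tilde K)}$ be the sound speed, where $\hat K=p+\frac{4ae^4}{3C_v^4}$ and $\tilde K=\rho+\frac{4ae^3}{C_v^4}$. Consider the $x$-split system of the two-dimensional radiation hydrodynamical equations $$\partial_t U+\partial_x F(U)=0,\qquad U=(\rho,\rho u,\rho v,E)^T,\quad F(U)=(\rho u,\ \rho u^2+p_{tot},\ \rho uv,\ u(E+p_{tot}))^T ,$$ with initial data $U(x,0)=U_L+xU'_L$ for $x<0$ and $U(x,0)=U_R+xU'_R$ for $x>0$ (near $x=0$), where $U_L,U_R$ are physical states and $U_L',U_R'$ are constant vectors. Let $v'_L$, $v'_R$ be the resulting slopes $\partial v/\partial x$ of the initial data at $x=0^-$, $x=0^+$. Suppose that the solution $\omega(x/t)$ of the associated Riemann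 problem with states $U_L,U_R$ consists of a $1$-rarefaction wave from $U_L$ to $U_1$, a contact discontinuity and shear wave of speed $u_*$ from $U_1$ to $U_2$ (across which $u$ and $p_{tot}$ are continuous, so that $U_1$ and $U_2$ have the same velocity $u=u_*$), and a Lax shock of the last family, of speed $\sigma_R$, from $U_2$ to $U_R$; and that the $t$-axis lies in the intermediate region, i.e. $u_*-c(U_1)<0<\sigma_R$. Let $U(x,t)$ be a piecewise smooth solution, near the origin and for small $t\ge 0$, of the initial value problem with this wave configuration: the two boundary curves of the (curved) rarefaction wave are $1$-characteristics, across which the solution is continuous; they, the contact curve and the shock curve all start at the origin; in each of the five regions between these curves the solution is $C^1$ up to the boundary curves, except possibly at the origin; and in each region it tends to the solution $\omega(x/t)$ of the Riemann problem as $(x,t)\to(0,0)$. Write $(\cdot)_*$ for limits along $x=0$ as $t\to0^+$. Then: (i) if $u_*>0$, then $U_*=U_1$, the limit $(\partial v/\partial t)_*$ exists, and, with $\rho_*$ the density of $U_1$, $$\left(\frac{\partial v}{\partial t}\right)_*=-\frac{\rho_*u_*}{\rho_L}\,v'_L;$$ (ii) if $u_*<0$, then $U_*=U_2$, the limit $(\partial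 v/\partial t)_*$ exists, and $$\left(\frac{\partial v}{\partial t}\right)_*=-\frac{u_*(\sigma_R-u_R)}{\sigma_R-u_*}\,v'_R .$$ -/

import Mathlib

open Set Filter Topology

noncomputable section

namespace RHE

/-- A gas state in primitive variables `(ρ, u, v, e)`: density, the two velocity components and
specific internal energy. -/
abbrev State := Fin 4 → ℝ

def rho (W : State) : ℝ := W 0
def velX (W : State) : ℝ := W 1
def velY (W : State) : ℝ := W 2
def inten (W : State) : ℝ := W 3

/-- Physical states. -/
def Physical (W : State) : Prop := 0 < rho W ∧ 0 < inten W

/-- Temperature, from `e = C_v T`. -/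
def temp (Cv : ℝ) (W : State) : ℝ := inten W / Cv

/-- Perfect gas pressure `p = (γ - 1) ρ e`. -/
def pres (γ : ℝ) (W : State) : ℝ := (γ - 1) * rho W * inten W

/-- Total pressure `p + a T⁴ / 3`. -/
def ptot (γ a Cv : ℝ) (W : State) : ℝ := pres γ W + a * temp Cv W ^ 4 / 3

/-- Total specific internal energy `e + a T⁴ / ρ`. -/
def etot (a Cv : ℝ) (W : State) : ℝ := inten W + a * temp Cv W ^ 4 / rho W

/-- Total energy `ρ (u² + v²) / 2 + ρ e_tot`. -/
def energy (a Cv : ℝ) (W : State) : ℝ :=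
  rho W * (velX W ^ 2 + velY W ^ 2) / 2 + rho W * etot a Cv W

/-- Sound speed, `c² = p / ρ + K̂² / (ρ e K̃)` with `K̂ = p + 4 a e⁴ / (3 C_v⁴)` and
`K̃ = ρ + 4 a e³ / C_v⁴`. -/
def sound (γ a Cv : ℝ) (W : State) : ℝ :=
  Real.sqrt (pres γ W / rho W +
    (pres γ W + 4 * a * inten W ^ 4 / (3 * Cv ^ 4)) ^ 2 /
      (rho W * inten W * (rho W + 4 * a * inten W ^ 3 / Cv ^ 4)))

/-- The first characteristic speed `u - c`. -/
def lam1 (γ a Cv : ℝ) (W : State) : ℝ := velX W - sound γ a Cv W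

/-- The last characteristic speed `u + c`. -/
def lam4 (γ a Cv : ℝ) (W : State) : ℝ := velX W + sound γ a Cv W

/-- The conserved vector `U = (ρ, ρ u, ρ v, E)`. -/
def cons (a Cv : ℝ) (W : State) : Fin 4 → ℝ :=
  ![rho W, rho W * velX W, rho W * velY W, energy a Cv W]

/-- The flux in the `x` direction, `(ρ u, ρ u² + p_tot, ρ u v, u (E + p_tot))`. -/
def flux (γ a Cv : ℝ) (W : State) : Fin 4 → ℝ :=
  ![rho W * velX W, rho W * velX W ^ 2 + ptot γ a Cv W, rho W * velX W * velY W,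
    velX W * (energy a Cv W + ptot γ a Cv W)]

/-- The `x`-split system `∂U/∂t + ∂F(U)/∂x = 0` at every point `(x, t)` of `Ω`; to be used for
functions that are differentiable on the open set `Ω`. -/
def XSplitOn (γ a Cv : ℝ) (W : ℝ × ℝ → State) (Ω : Set (ℝ × ℝ)) : Prop :=
  ∀ z ∈ Ω, ∀ k : Fin 4,
    deriv (fun t => cons a Cv (W (z.1, t)) k) z.2 +
      deriv (fun x => flux γ a Cv (W (x, z.2)) k) z.1 = 0

/-- A shock of the last family, with speed `s`, state `A` on the left and `B` on the right:
Rankine-Hugoniot conditions and Lax conditions. -/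
structure LastShock (γ a Cv s : ℝ) (A B : State) : Prop where
  jump : flux γ a Cv B - flux γ a Cv A = s • (cons a Cv B - cons a Cv A)
  lax_right : lam4 γ a Cv B < s
  lax_left : s < lam4 γ a Cv A
  lax_mid : velX A < s

/-- `ω (x / t)` is the solution of the Riemann problem with left state `UL` and right state `UR`,
consisting of a 1-rarefaction wave from `UL` to `U1`, a contact discontinuity (with shear) from `U1`
to `U2` and a shock of the last family, of speed `σ`, from `U2` to `UR`. -/
structure IsRiemannSolution (γ a Cv : ℝ) (UL U1 U2 UR : State) (σ : ℝ) (ω : ℝ → State) :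
    Prop where
  physical_L : Physical UL
  physical_one : Physical U1
  physical_two : Physical U2
  physical_R : Physical UR
  fan_spread : lam1 γ a Cv UL < lam1 γ a Cv U1
  eq_L : ∀ ξ ≤ lam1 γ a Cv UL, ω ξ = UL
  fan_continuous : ContinuousOn ω (Icc (lam1 γ a Cv UL) (lam1 γ a Cv U1))
  fan_differentiable : DifferentiableOn ℝ ω (Ioo (lam1 γ a Cv UL) (lam1 γ a Cv U1))
  fan_physical : ∀ ξ ∈ Ioo (lam1 γ a Cv UL) (lam1 γ a Cv U1), Physical (ω ξ)
  fan_speed : ∀ ξ ∈ Ioo (lam1 γ a Cv UL) (lam1 γ a Cv U1), lam1 γ a Cv (ω ξ) = ξ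
  fan_solves : XSplitOn γ a Cv (fun z => ω (z.1 / z.2))
    {z | 0 < z.2 ∧ z.1 / z.2 ∈ Ioo (lam1 γ a Cv UL) (lam1 γ a Cv U1)}
  eq_one : ∀ ξ ∈ Ico (lam1 γ a Cv U1) (velX U1), ω ξ = U1
  contact_vel : velX U1 = velX U2
  contact_ptot : ptot γ a Cv U1 = ptot γ a Cv U2
  eq_two : ∀ ξ ∈ Ioo (velX U2) σ, ω ξ = U2
  shock : LastShock γ a Cv σ U2 UR
  eq_R : ∀ ξ, σ < ξ → ω ξ = UR

/-- The region between the curves `x = f t` and `x = g t`, for `0 ≤ t < T`. -/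
def sector (T : ℝ) (f g : ℝ → ℝ) : Set (ℝ × ℝ) :=
  {z | 0 ≤ z.2 ∧ z.2 < T ∧ f z.2 < z.1 ∧ z.1 < g z.2}

/-- The same region together with the two curves, but without the origin. -/
def closedSector (T : ℝ) (f g : ℝ → ℝ) : Set (ℝ × ℝ) :=
  {z | 0 ≤ z.2 ∧ z.2 < T ∧ f z.2 ≤ z.1 ∧ z.1 ≤ g z.2 ∧ z ≠ 0}

/-- Between the curves `f` and `g` the field `W` is a smooth solution: it coincides with a function
`V` that is `C¹` up to the two curves (but not necessarily up to the origin), and it solves the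
`x`-split system for `t > 0`. So `V` gives the one-sided limits of `W` on the curves. -/
structure SmoothPiece (γ a Cv T : ℝ) (f g : ℝ → ℝ) (W V : ℝ × ℝ → State) : Prop where
  agree : EqOn W V (sector T f g)
  regular : ContDiffOn ℝ 1 V (closedSector T f g)
  physical : ∀ z ∈ closedSector T f g, Physical (V z)
  solves : XSplitOn γ a Cv W (sector T f g ∩ {z | 0 < z.2})

/-- `W` is a piecewise smooth solution, on `(-r, r) × [0, T)`, of the generalized Riemann problem
with initial data `U_L + x U'_L` for `x < 0` and `U_R + x U'_R` for `x > 0`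
(where `U_L`, `U_R` are the conserved vectors of `UL`, `UR`, and `dL`, `dR` stand for `U'_L`,
`U'_R`), with the configuration: curved 1-rarefaction wave between the characteristics `x = x₀ t`
and `x = x₁ t`, contact discontinuity `x = x₂ t`, shock `x = x₃ t`, all issuing from the origin.
As the origin is approached, `W` tends to the solution `ω (x / t)` of the associated Riemann
problem. -/
structure IsGRPSolution (γ a Cv r T : ℝ) (UL U1 U2 UR : State) (ω : ℝ → State)
    (dL dR : Fin 4 → ℝ) (W : ℝ × ℝ → State) (x₀ x₁ x₂ x₃ : ℝ → ℝ)
    (VL VF V1 V2 VR : ℝ × ℝ → State) : Prop where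
  init_L : ∀ x ∈ Ioo (-r) 0, cons a Cv (W (x, 0)) = cons a Cv UL + x • dL
  init_R : ∀ x ∈ Ioo 0 r, cons a Cv (W (x, 0)) = cons a Cv UR + x • dR
  start : x₀ 0 = 0 ∧ x₁ 0 = 0 ∧ x₂ 0 = 0 ∧ x₃ 0 = 0
  continuous₀ : ContinuousOn x₀ (Ico 0 T)
  continuous₁ : ContinuousOn x₁ (Ico 0 T)
  continuous₂ : ContinuousOn x₂ (Ico 0 T)
  continuous₃ : ContinuousOn x₃ (Ico 0 T)
  order : ∀ t ∈ Ioo 0 T, -r < x₀ t ∧ x₀ t < x₁ t ∧ x₁ t < x₂ t ∧ x₂ t < x₃ t ∧ x₃ t < r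
  piece_L : SmoothPiece γ a Cv T (fun _ => -r) x₀ W VL
  piece_F : SmoothPiece γ a Cv T x₀ x₁ W VF
  piece_one : SmoothPiece γ a Cv T x₁ x₂ W V1
  piece_two : SmoothPiece γ a Cv T x₂ x₃ W V2
  piece_R : SmoothPiece γ a Cv T x₃ (fun _ => r) W VR
  head : ∀ t ∈ Ioo 0 T, VL (x₀ t, t) = VF (x₀ t, t) ∧
    HasDerivAt x₀ (lam1 γ a Cv (VF (x₀ t, t))) t
  tail : ∀ t ∈ Ioo 0 T, VF (x₁ t, t) = V1 (x₁ t, t) ∧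
    HasDerivAt x₁ (lam1 γ a Cv (VF (x₁ t, t))) t
  contact : ∀ t ∈ Ioo 0 T,
    HasDerivAt x₂ (velX (V1 (x₂ t, t))) t ∧
    velX (V1 (x₂ t, t)) = velX (V2 (x₂ t, t)) ∧
    ptot γ a Cv (V1 (x₂ t, t)) = ptot γ a Cv (V2 (x₂ t, t))
  shock : ∀ t ∈ Ioo 0 T, ∃ s : ℝ, HasDerivAt x₃ s t ∧
    LastShock γ a Cv s (V2 (x₃ t, t)) (VR (x₃ t, t))
  limit_L : Tendsto VL (𝓝[closedSector T (fun _ => -r) x₀] 0) (𝓝 UL)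
  limit_F : Tendsto (fun z => VF z - ω (z.1 / z.2)) (𝓝[closedSector T x₀ x₁] 0) (𝓝 0)
  limit_one : Tendsto V1 (𝓝[closedSector T x₁ x₂] 0) (𝓝 U1)
  limit_two : Tendsto V2 (𝓝[closedSector T x₂ x₃] 0) (𝓝 U2)
  limit_R : Tendsto VR (𝓝[closedSector T x₃ (fun _ => r)] 0) (𝓝 UR)

/-- The slope `v' = (∂v/∂x)(0)` of the transversal velocity `v = (ρ v) / ρ` in the linear data
`U + x U'`, where `U` is the conserved vector of `A` and `d` stands for `U'`. -/
def slopeY (a Cv : ℝ) (A : State) (d : Fin 4 → ℝ) : ℝ :=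
  deriv (fun x : ℝ => (cons a Cv A + x • d) 2 / (cons a Cv A + x • d) 0) 0

/-- `(∂f/∂t)_* = d`: the time derivative of `f` exists at `(0, t)` for all small `t > 0`, and it
tends to `d` as `t → 0+`. -/
def HasTimeDerivStar (f : ℝ × ℝ → ℝ) (d : ℝ) : Prop :=
  (∀ᶠ t in 𝓝[>] (0 : ℝ), DifferentiableAt ℝ (fun s => f (0, s)) t) ∧
    Tendsto (fun t => deriv (fun s => f (0, s)) t) (𝓝[>] 0) (𝓝 d)

end RHE

end

namespace RHE

open MeasureTheory

/-! The transversal velocity obeys `v_t + u v_x = 0`, so it is constant along particle paths, and so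
is the mass coordinate `m`, the potential of the closed form `ρ dx - ρ u dt`, normalised to vanish
on the contact curve. Hence `v = G(m)` on the whole upstream side of the contact, with `G` read off
from the initial data. On the `t`-axis this gives `v_t = -G'(m) ρ u`, and `m → 0` at the origin. The
data satisfy `v(x, 0) = G(m(x, 0))` with `m_x = ρ`, so `G'(0) ρ_L = v'_L`, and (i) follows. No
thermodynamics and no expansion of the rarefaction wave enter: only mass, transversal momentum, and
continuity of `v` and of the mass flux across the curves.

The difficulty is the origin, where derivatives may blow up in the fan, so that tracing particle
paths back to `t = 0` is delicate. An energy argument replaces this. Let `E(t)` be the integral of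
`ρ (v - G(m))²` between a curve `y₀` moving at least as fast as the fluid and the contact. Reynolds'
theorem (`hasDerivAt_integral_moving`) makes `E` nonincreasing: nothing crosses the contact, the
interior fluxes cancel, and mass only leaves through `y₀`. Moreover `E → 0` as `t → 0`, by dominated
convergence on the outer layer and because the other layers shrink to a point while the integrand
stays bounded. So `E = 0`, that is, `v = G(m)`; this is `Layer.hasDerivAt_of_initial`.

Case (ii) is the mirror image. The reflection `x ↦ -x` turns the right-hand side into the same
configuration. At the shock the mass flux is continuous and nonzero, which forces `v` to be
continuous, and its continuity `ρ_* (σ_R - u_*) = ρ_R (σ_R - u_R)` converts the density ratio into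
the stated factor. -/

theorem clm_apply_prod (L : ℝ × ℝ →L[ℝ] ℝ) (a b : ℝ) :
    L (a, b) = a * L (1, 0) + b * L (0, 1) := by
  have h : ((a, b) : ℝ × ℝ) = a • ((1, 0) : ℝ × ℝ) + b • ((0, 1) : ℝ × ℝ) := by
    ext <;> simp
  rw [h, map_add, map_smul, map_smul, smul_eq_mul, smul_eq_mul]

/-! ### Functions with locally bounded derivative up to the boundary. -/

/-- Functions that are continuous on `K`, of class `C¹` on `Ω`, and whose derivative on `Ω` is
bounded near every point of `K`. -/
structure TameOn (Ω K : Set (ℝ × ℝ)) (h : ℝ × ℝ → ℝ) : Prop where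
  cont : ContinuousOn h K
  smooth : ContDiffOn ℝ 1 h Ω
  bdd : ∀ z ∈ K, ∃ C, ∀ᶠ w in 𝓝[Ω] z, ‖fderiv ℝ h w‖ ≤ C

namespace TameOn

variable {Ω K : Set (ℝ × ℝ)} {h k : ℝ × ℝ → ℝ}

theorem differentiableAt (hh : TameOn Ω K h) (hΩ : IsOpen Ω) {z : ℝ × ℝ} (hz : z ∈ Ω) :
    DifferentiableAt ℝ h z :=
  (hh.smooth.contDiffAt (hΩ.mem_nhds hz)).differentiableAt one_ne_zero

theorem eventually_abs_le (hh : TameOn Ω K h) (hΩK : Ω ⊆ K) {z : ℝ × ℝ} (hz : z ∈ K) :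
    ∀ᶠ w in 𝓝[Ω] z, |h w| ≤ |h z| + 1 := by
  have h1 : Tendsto (fun w => |h w|) (𝓝[Ω] z) (𝓝 |h z|) :=
    ((hh.cont z hz).mono hΩK).abs
  exact h1.eventually (eventually_le_nhds (lt_add_one _))

theorem mono {Ω' K' : Set (ℝ × ℝ)} (hh : TameOn Ω K h) (hΩ : Ω' ⊆ Ω) (hK : K' ⊆ K) :
    TameOn Ω' K' h where
  cont := hh.cont.mono hK
  smooth := hh.smooth.mono hΩ
  bdd z hz := by
    obtain ⟨C, hC⟩ := hh.bdd z (hK hz)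
    exact ⟨C, hC.filter_mono (nhdsWithin_mono _ hΩ)⟩

theorem mul (hh : TameOn Ω K h) (hk : TameOn Ω K k) (hΩ : IsOpen Ω) (hΩK : Ω ⊆ K) :
    TameOn Ω K (fun z => h z * k z) where
  cont := hh.cont.mul hk.cont
  smooth := hh.smooth.mul hk.smooth
  bdd z hz := by
    obtain ⟨C, hC⟩ := hh.bdd z hz
    obtain ⟨D, hD⟩ := hk.bdd z hz
    refine ⟨(|h z| + 1) * D + (|k z| + 1) * C, ?_⟩
    filter_upwards [hC, hD, hh.eventually_abs_le hΩK hz, hk.eventually_abs_le hΩK hz,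
      self_mem_nhdsWithin] with w h1 h2 h3 h4 h5
    rw [fderiv_fun_mul (hh.differentiableAt hΩ h5) (hk.differentiableAt hΩ h5)]
    refine (norm_add_le _ _).trans ?_
    rw [norm_smul, norm_smul, Real.norm_eq_abs, Real.norm_eq_abs]
    gcongr

theorem sub (hh : TameOn Ω K h) (hk : TameOn Ω K k) (hΩ : IsOpen Ω) :
    TameOn Ω K (fun z => h z - k z) where
  cont := hh.cont.sub hk.cont
  smooth := hh.smooth.sub hk.smooth
  bdd z hz := by
    obtain ⟨C, hC⟩ := hh.bdd z hz
    obtain ⟨D, hD⟩ := hk.bdd z hz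
    refine ⟨C + D, ?_⟩
    filter_upwards [hC, hD, self_mem_nhdsWithin] with w h1 h2 h5
    rw [fderiv_fun_sub (hh.differentiableAt hΩ h5) (hk.differentiableAt hΩ h5)]
    exact (norm_sub_le _ _).trans (add_le_add h1 h2)

theorem comp (hh : TameOn Ω K h) (hΩ : IsOpen Ω) (hΩK : Ω ⊆ K) {G : ℝ → ℝ} {I : Set ℝ}
    (hI : IsOpen I) (hG : ContDiffOn ℝ 1 G I) (hm : MapsTo h K I) :
    TameOn Ω K (fun z => G (h z)) where
  cont := hG.continuousOn.comp hh.cont hm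
  smooth := hG.comp hh.smooth (hm.mono_left hΩK)
  bdd z hz := by
    obtain ⟨C, hC⟩ := hh.bdd z hz
    have h1 : ContinuousAt (deriv G) (h z) :=
      (hG.continuousOn_deriv_of_isOpen hI le_rfl).continuousAt (hI.mem_nhds (hm hz))
    have h2 : Tendsto (fun w => |deriv G (h w)|) (𝓝[Ω] z) (𝓝 |deriv G (h z)|) :=
      (h1.tendsto.comp ((hh.cont z hz).mono hΩK)).abs
    refine ⟨(|deriv G (h z)| + 1) * C, ?_⟩
    filter_upwards [hC, h2.eventually (eventually_le_nhds (lt_add_one _)),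
      self_mem_nhdsWithin] with w h3 h4 h5
    have h6 : DifferentiableAt ℝ G (h w) :=
      (hG.contDiffAt (hI.mem_nhds (hm (hΩK h5)))).differentiableAt one_ne_zero
    have h7 := (h6.hasDerivAt.comp_hasFDerivAt w (hh.differentiableAt hΩ h5).hasFDerivAt).fderiv
    have h8 : fderiv ℝ (fun z => G (h z)) w = deriv G (h w) • fderiv ℝ h w := h7
    rw [h8, norm_smul, Real.norm_eq_abs]
    gcongr

end TameOn

/-- `C¹` on `K` supplies, near each point of `K`, some derivative within `K` that is continuous at
that point. On the open set `Ω` it has to be the true derivative, which is therefore bounded there.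
-/
theorem tameOn_of_contDiffOn {Ω K : Set (ℝ × ℝ)} {h : ℝ × ℝ → ℝ} (hΩ : IsOpen Ω) (hΩK : Ω ⊆ K)
    (hh : ContDiffOn ℝ 1 h K) : TameOn Ω K h where
  cont := hh.continuousOn
  smooth := hh.mono hΩK
  bdd z hz := by
    have h1 : ContDiffWithinAt ℝ (0 + 1) h K z := by simpa using hh z hz
    rw [contDiffWithinAt_succ_iff_hasFDerivWithinAt' (by simp)] at h1
    obtain ⟨u, hu, -, -, f', hf', hc⟩ := h1
    rw [insert_eq_of_mem hz] at hu
    have h2 : Tendsto (fun w => ‖f' w‖) (𝓝[K] z) (𝓝 ‖f' z‖) := hc.continuousWithinAt.norm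
    refine ⟨‖f' z‖ + 1, ?_⟩
    filter_upwards [(h2.mono_left (nhdsWithin_mono z hΩK)).eventually
      (eventually_le_nhds (lt_add_one _)), nhdsWithin_mono z hΩK hu, self_mem_nhdsWithin]
      with w h3 h4 h5
    rwa [((hf' w h4).hasFDerivAt (mem_of_superset (hΩ.mem_nhds h5) hΩK)).fderiv]

/-! ### Reynolds' transport theorem between moving curves. -/

/-- The point with relative position `s` between the curves `f` and `g`, at time `t`. -/
def between (f g : ℝ → ℝ) (t s : ℝ) : ℝ × ℝ := (f t + (g t - f t) * s, t)

/-- Compactness of `[0, 1]` turns the local bounds at the points of the slice `t = t₀` into one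
bound for all nearby slices. This is the domination needed to differentiate under the integral sign.
-/
theorem exists_bound_between {Ω K : Set (ℝ × ℝ)} {h : ℝ × ℝ → ℝ} (hh : TameOn Ω K h)
    (hΩK : Ω ⊆ K) {f g : ℝ → ℝ} {t₀ : ℝ} (hf : ContinuousAt f t₀) (hg : ContinuousAt g t₀)
    (hK : ∀ s ∈ Icc (0 : ℝ) 1, between f g t₀ s ∈ K)
    (hin : ∀ᶠ t in 𝓝 t₀, ∀ s ∈ Ioo (0 : ℝ) 1, between f g t s ∈ Ω) :
    ∃ C, 0 ≤ C ∧ ∀ᶠ t in 𝓝 t₀, ∀ s ∈ Ioo (0 : ℝ) 1,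
      |h (between f g t s)| ≤ C ∧ ‖fderiv ℝ h (between f g t s)‖ ≤ C := by
  have key : ∃ C, 0 ≤ C ∧ ∀ᶠ t in 𝓝 t₀, ∀ s ∈ Icc (0 : ℝ) 1, s ∈ Ioo (0 : ℝ) 1 →
      |h (between f g t s)| ≤ C ∧ ‖fderiv ℝ h (between f g t s)‖ ≤ C := by
    refine isCompact_Icc.induction_on
      (p := fun S => ∃ C, 0 ≤ C ∧ ∀ᶠ t in 𝓝 t₀, ∀ s ∈ S, s ∈ Ioo (0 : ℝ) 1 →
        |h (between f g t s)| ≤ C ∧ ‖fderiv ℝ h (between f g t s)‖ ≤ C) ?_ ?_ ?_ ?_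
    · exact ⟨0, le_rfl, by simp⟩
    · rintro A B hAB ⟨C, h0, hC⟩
      exact ⟨C, h0, hC.mono fun t ht s hs => ht s (hAB hs)⟩
    · rintro A B ⟨C, h0, hC⟩ ⟨D, h1, hD⟩
      refine ⟨max C D, le_max_of_le_left h0, ?_⟩
      filter_upwards [hC, hD] with t h2 h3 s hs hs'
      rcases hs with hs | hs
      · exact ⟨(h2 s hs hs').1.trans (le_max_left _ _), (h2 s hs hs').2.trans (le_max_left _ _)⟩
      · exact ⟨(h3 s hs hs').1.trans (le_max_right _ _), (h3 s hs hs').2.trans (le_max_right _ _)⟩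
    · intro s₀ hs₀
      obtain ⟨C, hC⟩ := hh.bdd _ (hK s₀ hs₀)
      have h1 := hC.and (hh.eventually_abs_le hΩK (hK s₀ hs₀))
      rw [eventually_nhdsWithin_iff] at h1
      have hcont : ContinuousAt (fun p : ℝ × ℝ => between f g p.1 p.2) (t₀, s₀) := by
        have hf' : ContinuousAt (fun p : ℝ × ℝ => f p.1) (t₀, s₀) :=
          ContinuousAt.comp (f := Prod.fst) (g := f) hf continuousAt_fst
        have hg' : ContinuousAt (fun p : ℝ × ℝ => g p.1) (t₀, s₀) :=
          ContinuousAt.comp (f := Prod.fst) (g := g) hg continuousAt_fst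
        exact (hf'.add ((hg'.sub hf').mul continuousAt_snd)).prodMk continuousAt_fst
      have h2 := hcont.eventually h1
      rw [nhds_prod_eq, eventually_prod_iff] at h2
      obtain ⟨pt, hpt, ps, hps, hp⟩ := h2
      refine ⟨{s | ps s}, mem_nhdsWithin_of_mem_nhds hps,
        max C (|h (between f g t₀ s₀)| + 1), le_max_of_le_right (by positivity), ?_⟩
      filter_upwards [hpt, hin] with t h3 h4 s hs hs'
      have h5 := hp h3 hs (h4 s hs')
      exact ⟨h5.2.trans (le_max_right _ _), h5.1.trans (le_max_left _ _)⟩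
  obtain ⟨C, h0, hC⟩ := key
  exact ⟨C, h0, hC.mono fun t ht s hs => ht s (Ioo_subset_Icc_self hs) hs⟩

theorem integral_between (h : ℝ × ℝ → ℝ) (f g : ℝ → ℝ) (t : ℝ) :
    ∫ y in f t..g t, h (y, t) = ∫ s in (0 : ℝ)..1, h (between f g t s) * (g t - f t) := by
  rw [intervalIntegral.integral_mul_const, mul_comm]
  have := intervalIntegral.mul_integral_comp_add_mul (a := 0) (b := 1)
    (f := fun y => h (y, t)) (c := g t - f t) (d := f t)
  simp only [mul_zero, add_zero, mul_one, add_sub_cancel] at this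
  exact this.symm

/-- Reynolds' transport theorem for a balance law `R_t + Q_x = 0` between two moving curves. -/
theorem hasDerivAt_integral_moving {Ω K : Set (ℝ × ℝ)} {R Q : ℝ × ℝ → ℝ} (hΩ : IsOpen Ω)
    (hΩK : Ω ⊆ K) (hR : TameOn Ω K R) (hQ : ContinuousOn Q K)
    (hQx : ∀ z ∈ Ω, HasDerivAt (fun x => Q (x, z.2)) (-(fderiv ℝ R z (0, 1))) z.1)
    {f g f' g' : ℝ → ℝ} {t₀ : ℝ}
    (hf : ∀ᶠ t in 𝓝 t₀, HasDerivAt f (f' t) t) (hg : ∀ᶠ t in 𝓝 t₀, HasDerivAt g (g' t) t)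
    (hf' : ContinuousAt f' t₀) (hg' : ContinuousAt g' t₀)
    (hK : ∀ᶠ t in 𝓝 t₀, ∀ s ∈ Icc (0 : ℝ) 1, between f g t s ∈ K)
    (hin : ∀ᶠ t in 𝓝 t₀, ∀ s ∈ Ioo (0 : ℝ) 1, between f g t s ∈ Ω) :
    HasDerivAt (fun t => ∫ y in f t..g t, R (y, t))
      (R (g t₀, t₀) * g' t₀ - Q (g t₀, t₀) - (R (f t₀, t₀) * f' t₀ - Q (f t₀, t₀))) t₀ := by
  simp_rw [integral_between R f g]
  have cf := hf.self_of_nhds.continuousAt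
  have cg := hg.self_of_nhds.continuousAt
  obtain ⟨C, hC0, hC⟩ := exists_bound_between hR hΩK cf cg hK.self_of_nhds hin
  have e1 := hf'.abs.eventually (eventually_le_nhds (lt_add_one |f' t₀|))
  have e2 := hg'.abs.eventually (eventually_le_nhds (lt_add_one |g' t₀|))
  have e3 := (cg.sub cf).abs.eventually (eventually_le_nhds (lt_add_one |g t₀ - f t₀|))
  set A := |f' t₀| + 1
  set B := |g' t₀| + 1
  set D := |g t₀ - f t₀| + 1
  have hA : 0 ≤ A := by positivity
  have hB : 0 ≤ B := by positivity
  have hD : 0 ≤ D := by positivity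
  -- After rescaling to the fixed interval `[0, 1]`, this is the time derivative of the integrand:
  -- `R` is differentiated along a point of fixed relative position, and the length `g - f` is
  -- differentiated too.
  let F' : ℝ → ℝ → ℝ := fun t s =>
    fderiv ℝ R (between f g t s) (f' t + (g' t - f' t) * s, 1) * (g t - f t) +
      R (between f g t s) * (g' t - f' t)
  have hev := hf.and <| hg.and <| hK.and <| hin.and <| hC.and <| e1.and <| e2.and e3
  have hslice : ∀ t, (∀ s ∈ Icc (0 : ℝ) 1, between f g t s ∈ K) →
      ∀ {h : ℝ × ℝ → ℝ}, ContinuousOn h K →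
        ContinuousOn (fun s => h (between f g t s)) (Icc 0 1) := by
    intro t ht h hh
    refine hh.comp (Continuous.continuousOn ?_) ht
    unfold between; fun_prop
  have hIoc : (uIoc (0 : ℝ) 1) = Ioc 0 1 := uIoc_of_le zero_le_one
  have hmeas : AEStronglyMeasurable (F' t₀) (volume.restrict (uIoc (0 : ℝ) 1)) := by
    rw [hIoc, ← restrict_Ioo_eq_restrict_Ioc]
    have hb : ContinuousOn (fun s => between f g t₀ s) (Ioo (0 : ℝ) 1) := by
      refine Continuous.continuousOn ?_
      unfold between; fun_prop
    have h1 : ContinuousOn (fun s => fderiv ℝ R (between f g t₀ s)) (Ioo (0 : ℝ) 1) :=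
      (hR.smooth.continuousOn_fderiv_of_isOpen hΩ le_rfl).comp hb hin.self_of_nhds
    have h2 : ContinuousOn (fun s => R (between f g t₀ s)) (Ioo (0 : ℝ) 1) :=
      (hslice t₀ hK.self_of_nhds hR.cont).mono Ioo_subset_Icc_self
    have h3 : Continuous fun s : ℝ => ((f' t₀ + (g' t₀ - f' t₀) * s, 1) : ℝ × ℝ) := by fun_prop
    exact (((h1.clm_apply h3.continuousOn).mul continuousOn_const).add
      (h2.mul continuousOn_const)).aestronglyMeasurable measurableSet_Ioo
  have main := intervalIntegral.hasDerivAt_integral_of_dominated_loc_of_deriv_le (μ := volume)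
    (a := 0) (b := 1) (F := fun t s => R (between f g t s) * (g t - f t)) (F' := F')
    (bound := fun _ => C * (A + (B + A) + 1) * D + C * (B + A)) (x₀ := t₀) hev
    (hK.mono fun t ht => by
      rw [hIoc]
      exact (((hslice t ht hR.cont).mono Ioc_subset_Icc_self).mul
        continuousOn_const).aestronglyMeasurable measurableSet_Ioc)
    (by
      refine ContinuousOn.intervalIntegrable ?_
      rw [uIcc_of_le zero_le_one]
      exact (hslice t₀ hK.self_of_nhds hR.cont).mul continuousOn_const)
    hmeas ?_ intervalIntegrable_const ?_
  · refine main.2.congr_deriv ?_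
    -- By the balance law `R_t = -Q_x`, the integrand `F' t₀` is an exact `s`-derivative: that of
    -- `R` times the speed of the point of relative position `s`, minus `Q`. Only boundary terms
    -- remain.
    rw [intervalIntegral.integral_eq_sub_of_hasDerivAt_of_le
      (f := fun s => R (between f g t₀ s) * (f' t₀ + (g' t₀ - f' t₀) * s) -
        Q (between f g t₀ s)) zero_le_one ?_ ?_ main.1]
    · simp only [between]; ring_nf
    · exact ((hslice t₀ hK.self_of_nhds hR.cont).mul (by fun_prop)).sub
        (hslice t₀ hK.self_of_nhds hQ)
    · intro s hs
      have hz := hin.self_of_nhds s hs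
      have hp : HasDerivAt (fun s => f t₀ + (g t₀ - f t₀) * s) (g t₀ - f t₀) s := by
        simpa using ((hasDerivAt_id s).const_mul (g t₀ - f t₀)).const_add (f t₀)
      have hp2 : HasDerivAt (fun s => f' t₀ + (g' t₀ - f' t₀) * s) (g' t₀ - f' t₀) s := by
        simpa using ((hasDerivAt_id s).const_mul (g' t₀ - f' t₀)).const_add (f' t₀)
      have hb : HasDerivAt (fun s => between f g t₀ s) (g t₀ - f t₀, 0) s :=
        hp.prodMk (hasDerivAt_const s t₀)
      have h1 := (hR.differentiableAt hΩ hz).hasFDerivAt.comp_hasDerivAt s hb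
      have h2 : HasDerivAt (fun s => Q (between f g t₀ s))
          (-(fderiv ℝ R (between f g t₀ s) (0, 1)) * (g t₀ - f t₀)) s :=
        HasDerivAt.comp s (h₂ := fun x => Q (x, t₀)) (hQx _ hz) hp
      convert! (h1.mul hp2).sub h2 using 1
      simp only [F', Function.comp]
      rw [clm_apply_prod _ (f' t₀ + _) 1, clm_apply_prod _ (g t₀ - f t₀) 0]
      ring
  -- The integral runs over `(0, 1]`, but derivatives are controlled only in the interior; the
  -- endpoint is discarded as a null set.
  · have hne : ∀ᵐ s : ℝ, s ≠ 1 := by simp [ae_iff]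
    filter_upwards [hne] with s hs1 hs t ht
    rw [hIoc] at hs
    have hs' : s ∈ Ioo (0 : ℝ) 1 := ⟨hs.1, lt_of_le_of_ne hs.2 hs1⟩
    obtain ⟨-, -, -, -, hC, e1, e2, e3⟩ := ht
    obtain ⟨c1, c2⟩ := hC s hs'
    have e4 : |g' t - f' t| ≤ B + A := (abs_sub _ _).trans (add_le_add e2 e1)
    have e5 : ‖((f' t + (g' t - f' t) * s, 1) : ℝ × ℝ)‖ ≤ A + (B + A) + 1 := by
      rw [Prod.norm_def, max_le_iff]
      constructor
      · have : |(g' t - f' t) * s| ≤ B + A := by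
          rw [abs_mul, abs_of_pos hs'.1]
          exact (mul_le_of_le_one_right (abs_nonneg _) hs.2).trans e4
        have h6 := abs_add_le (f' t) ((g' t - f' t) * s)
        simp only [Real.norm_eq_abs]
        linarith
      · simp only [norm_one]; linarith
    refine (norm_add_le _ _).trans ?_
    rw [norm_mul, norm_mul, Real.norm_eq_abs (g t - f t), Real.norm_eq_abs (R _),
      Real.norm_eq_abs (g' t - f' t)]
    have e6 := (fderiv ℝ R (between f g t s)).le_opNorm (f' t + (g' t - f' t) * s, 1)
    have e7 := e6.trans (mul_le_mul c2 e5 (norm_nonneg _) hC0)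
    gcongr
    exact e3
  · have hne : ∀ᵐ s : ℝ, s ≠ 1 := by simp [ae_iff]
    filter_upwards [hne] with s hs1 hs t ht
    rw [hIoc] at hs
    have hs' : s ∈ Ioo (0 : ℝ) 1 := ⟨hs.1, lt_of_le_of_ne hs.2 hs1⟩
    obtain ⟨h1, h2, -, hin, -⟩ := ht
    have hb : HasDerivAt (fun t => between f g t s) (f' t + (g' t - f' t) * s, 1) t :=
      (h1.add ((h2.sub h1).mul_const s)).prodMk (hasDerivAt_id t)
    have h3 := HasFDerivAt.comp_hasDerivAt (f := fun t => between f g t s) t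
      (hR.differentiableAt hΩ (hin s hs')).hasFDerivAt hb
    exact h3.mul (h2.sub h1)

/-! ### Strips, and fluids transporting a scalar in them. -/

def openStrip (δ : ℝ) (f g : ℝ → ℝ) : Set (ℝ × ℝ) :=
  {z | 0 < z.2 ∧ z.2 < δ ∧ f z.2 < z.1 ∧ z.1 < g z.2}

def closedStrip (δ : ℝ) (f g : ℝ → ℝ) : Set (ℝ × ℝ) :=
  {z | 0 < z.2 ∧ z.2 < δ ∧ f z.2 ≤ z.1 ∧ z.1 ≤ g z.2}

theorem openStrip_subset (δ : ℝ) (f g : ℝ → ℝ) : openStrip δ f g ⊆ closedStrip δ f g :=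
  fun _ hz => ⟨hz.1, hz.2.1, hz.2.2.1.le, hz.2.2.2.le⟩

theorem isOpen_openStrip {δ : ℝ} {f g : ℝ → ℝ} (hf : ContinuousOn f (Ioo 0 δ))
    (hg : ContinuousOn g (Ioo 0 δ)) : IsOpen (openStrip δ f g) := by
  rw [isOpen_iff_mem_nhds]
  rintro ⟨x, t⟩ ⟨h0, h1, h2, h3⟩
  have ht : Ioo 0 δ ∈ 𝓝 t := Ioo_mem_nhds h0 h1
  have cf : ContinuousAt (fun z : ℝ × ℝ => f z.2) (x, t) :=
    ContinuousAt.comp (g := f) (f := Prod.snd) (hf.continuousAt ht) continuousAt_snd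
  have cg : ContinuousAt (fun z : ℝ × ℝ => g z.2) (x, t) :=
    ContinuousAt.comp (g := g) (f := Prod.snd) (hg.continuousAt ht) continuousAt_snd
  filter_upwards [continuousAt_snd.eventually (lt_mem_nhds h0),
    continuousAt_snd.eventually (gt_mem_nhds h1), cf.eventually_lt continuousAt_fst h2,
    continuousAt_fst.eventually_lt cg h3] with z a b c d
  exact ⟨a, b, c, d⟩

/-- `f` is a curve of class `C¹` on `(0, δ)`, with derivative `f'`. -/
structure IsC1Curve (δ : ℝ) (f f' : ℝ → ℝ) : Prop where
  hasDerivAt : ∀ t ∈ Ioo 0 δ, HasDerivAt f (f' t) t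
  continuousOn : ContinuousOn f' (Ioo 0 δ)

theorem IsC1Curve.continuousOn_curve {δ : ℝ} {f f' : ℝ → ℝ} (h : IsC1Curve δ f f') :
    ContinuousOn f (Ioo 0 δ) :=
  fun t ht => (h.hasDerivAt t ht).continuousAt.continuousWithinAt

/-- A strip between two curves in which a fluid of density `ρ` and velocity `u` transports the
quantity `v`. -/
structure Patch (δ : ℝ) (f f' g g' : ℝ → ℝ) (ρ u v : ℝ × ℝ → ℝ) : Prop where
  lt : ∀ t ∈ Ioo 0 δ, f t < g t
  left : IsC1Curve δ f f'
  right : IsC1Curve δ g g'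
  tame_rho : TameOn (openStrip δ f g) (closedStrip δ f g) ρ
  tame_u : TameOn (openStrip δ f g) (closedStrip δ f g) u
  tame_v : TameOn (openStrip δ f g) (closedStrip δ f g) v
  pos : ∀ z ∈ closedStrip δ f g, 0 < ρ z
  mass : ∀ z ∈ openStrip δ f g,
    fderiv ℝ ρ z (0, 1) + (fderiv ℝ ρ z (1, 0) * u z + ρ z * fderiv ℝ u z (1, 0)) = 0
  transport : ∀ z ∈ openStrip δ f g, fderiv ℝ v z (0, 1) + u z * fderiv ℝ v z (1, 0) = 0

/-- A patch in which the density and the transported quantity are bounded by `M`. -/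
structure Layer (δ M : ℝ) (f f' g g' : ℝ → ℝ) (ρ u v : ℝ × ℝ → ℝ) : Prop
    extends Patch δ f f' g g' ρ u v where
  rho_le : ∀ z ∈ closedStrip δ f g, ρ z ≤ M
  v_le : ∀ z ∈ closedStrip δ f g, |v z| ≤ M

/-! ### The mass potential. -/

/-- The potential of the closed form `ρ dx - ρ u dt` that takes the values `μ` on the curve `g`. -/
noncomputable def massPotential (g μ : ℝ → ℝ) (ρ : ℝ × ℝ → ℝ) (z : ℝ × ℝ) : ℝ :=
  μ z.2 - ∫ y in z.1..g z.2, ρ (y, z.2)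

theorem hasDerivAt_slice_fst {h : ℝ × ℝ → ℝ} {z : ℝ × ℝ} (hh : DifferentiableAt ℝ h z) :
    HasDerivAt (fun x => h (x, z.2)) (fderiv ℝ h z (1, 0)) z.1 :=
  HasFDerivAt.comp_hasDerivAt (f := fun x => (x, z.2)) z.1 hh.hasFDerivAt
    ((hasDerivAt_id z.1).prodMk (hasDerivAt_const z.1 z.2))

theorem hasDerivAt_slice_snd {h : ℝ × ℝ → ℝ} {z : ℝ × ℝ} (hh : DifferentiableAt ℝ h z) :
    HasDerivAt (fun t => h (z.1, t)) (fderiv ℝ h z (0, 1)) z.2 :=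
  HasFDerivAt.comp_hasDerivAt (f := fun t => (z.1, t)) z.2 hh.hasFDerivAt
    ((hasDerivAt_const z.2 z.1).prodMk (hasDerivAt_id z.2))

namespace Layer

variable {δ M : ℝ} {f f' g g' : ℝ → ℝ} {ρ u v : ℝ × ℝ → ℝ}

theorem isOpen (h : Layer δ M f f' g g' ρ u v) : IsOpen (openStrip δ f g) :=
  isOpen_openStrip h.left.continuousOn_curve h.right.continuousOn_curve

theorem between_mem_closed {x t s : ℝ} (ht : t ∈ Ioo 0 δ) (h1 : f t ≤ x)
    (h2 : x ≤ g t) (hs : s ∈ Icc (0 : ℝ) 1) :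
    (x + (g t - x) * s, t) ∈ closedStrip δ f g := by
  refine ⟨ht.1, ht.2, ?_, ?_⟩
  · have := mul_nonneg (sub_nonneg.2 h2) hs.1
    simp only; linarith
  · have := mul_le_mul_of_nonneg_left hs.2 (sub_nonneg.2 h2)
    simp only; linarith

theorem between_mem_open {x t s : ℝ} (ht : t ∈ Ioo 0 δ) (h1 : f t ≤ x)
    (h2 : x < g t) (hs : s ∈ Ioo (0 : ℝ) 1) :
    (x + (g t - x) * s, t) ∈ openStrip δ f g := by
  refine ⟨ht.1, ht.2, ?_, ?_⟩
  · have := mul_pos (sub_pos.2 h2) hs.1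
    simp only; linarith
  · have := mul_lt_mul_of_pos_left hs.2 (sub_pos.2 h2)
    simp only; linarith

/-- Conservation of the quantity `ρ φ(v)` in integrated form. -/
theorem hasDerivAt_integral (h : Layer δ M f f' g g' ρ u v) {w : ℝ × ℝ → ℝ}
    (hw : TameOn (openStrip δ f g) (closedStrip δ f g) w)
    (hw' : ∀ z ∈ openStrip δ f g, fderiv ℝ w z (0, 1) + u z * fderiv ℝ w z (1, 0) = 0)
    {a a' : ℝ → ℝ} {t₀ : ℝ} (ht₀ : t₀ ∈ Ioo 0 δ) (ha : ∀ᶠ t in 𝓝 t₀, HasDerivAt a (a' t) t)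
    (ha' : ContinuousAt a' t₀) (hfa : ∀ᶠ t in 𝓝 t₀, f t ≤ a t) (hag : ∀ᶠ t in 𝓝 t₀, a t < g t) :
    HasDerivAt (fun t => ∫ y in a t..g t, ρ (y, t) * w (y, t))
      (ρ (g t₀, t₀) * w (g t₀, t₀) * (g' t₀ - u (g t₀, t₀)) -
        ρ (a t₀, t₀) * w (a t₀, t₀) * (a' t₀ - u (a t₀, t₀))) t₀ := by
  have hΩ := h.isOpen
  have hΩK := openStrip_subset δ f g
  have htn : ∀ᶠ t in 𝓝 t₀, t ∈ Ioo 0 δ := Ioo_mem_nhds ht₀.1 ht₀.2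
  have key := hasDerivAt_integral_moving (Q := fun z => ρ z * w z * u z) hΩ hΩK
    (h.tame_rho.mul hw hΩ hΩK) ((h.tame_rho.cont.mul hw.cont).mul h.tame_u.cont) ?_ ha
    (htn.mono fun t ht => h.right.hasDerivAt t ht) ha'
    (h.right.continuousOn.continuousAt (Ioo_mem_nhds ht₀.1 ht₀.2)) ?_ ?_
  · exact key.congr_deriv (by ring)
  · intro z hz
    have dρ := h.tame_rho.differentiableAt hΩ hz
    have dw := hw.differentiableAt hΩ hz
    have du := h.tame_u.differentiableAt hΩ hz
    refine (((hasDerivAt_slice_fst dρ).mul (hasDerivAt_slice_fst dw)).mul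
      (hasDerivAt_slice_fst du)).congr_deriv ?_
    rw [fderiv_fun_mul dρ dw]
    simp only [add_apply, smul_apply, smul_eq_mul, Pi.mul_apply]
    linear_combination w z * h.mass z hz + ρ z * hw' z hz
  · filter_upwards [htn, hfa, hag] with t h1 h2 h3 s hs
    exact between_mem_closed h1 h2 h3.le hs
  · filter_upwards [htn, hfa, hag] with t h1 h2 h3 s hs
    exact between_mem_open h1 h2 h3 hs

theorem continuousOn_slice (_h : Layer δ M f f' g g' ρ u v) {w : ℝ × ℝ → ℝ}
    (hw : ContinuousOn w (closedStrip δ f g)) {t : ℝ} (ht : t ∈ Ioo 0 δ) :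
    ContinuousOn (fun y => w (y, t)) (Icc (f t) (g t)) :=
  hw.comp (by fun_prop) fun _ hy => ⟨ht.1, ht.2, hy.1, hy.2⟩

/-- The curve `c` is a reference curve, in the application the contact. Since the bound is measured
from `c` and not from `g`, it propagates from one layer to the next. -/
theorem abs_potential_le (h : Layer δ M f f' g g' ρ u v) {μ c : ℝ → ℝ} {z : ℝ × ℝ}
    (hz : z ∈ closedStrip δ f g) (hμ : |μ z.2| ≤ M * (c z.2 - g z.2)) :
    |massPotential g μ ρ z| ≤ M * (c z.2 - z.1) := by
  have h1 : ‖∫ y in z.1..g z.2, ρ (y, z.2)‖ ≤ M * |g z.2 - z.1| := by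
    refine intervalIntegral.norm_integral_le_of_norm_le_const fun y hy => ?_
    rw [uIoc_of_le hz.2.2.2] at hy
    have hy' : (y, z.2) ∈ closedStrip δ f g :=
      ⟨hz.1, hz.2.1, hz.2.2.1.trans hy.1.le, hy.2⟩
    rw [Real.norm_eq_abs, abs_of_pos (h.pos _ hy')]
    exact h.rho_le _ hy'
  rw [abs_of_nonneg (sub_nonneg.2 hz.2.2.2), Real.norm_eq_abs] at h1
  calc |massPotential g μ ρ z| ≤ |μ z.2| + |∫ y in z.1..g z.2, ρ (y, z.2)| := abs_sub _ _
    _ ≤ M * (c z.2 - g z.2) + M * (g z.2 - z.1) := add_le_add hμ h1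
    _ = M * (c z.2 - z.1) := by ring

/-- `μ` is the mass flux potential along the curve `g`. -/
def FluxAlong (δ : ℝ) (g g' : ℝ → ℝ) (ρ u : ℝ × ℝ → ℝ) (μ : ℝ → ℝ) : Prop :=
  ∀ t ∈ Ioo 0 δ, HasDerivAt μ (ρ (g t, t) * (g' t - u (g t, t))) t

theorem tameOn_one (Ω K : Set (ℝ × ℝ)) : TameOn Ω K (fun _ => 1) where
  cont := continuousOn_const
  smooth := contDiffOn_const
  bdd _ _ := ⟨0, by simp⟩

theorem hasDerivAt_potential_along (h : Layer δ M f f' g g' ρ u v) {μ : ℝ → ℝ}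
    (hμ : FluxAlong δ g g' ρ u μ) {a a' : ℝ → ℝ} {t₀ : ℝ} (ht₀ : t₀ ∈ Ioo 0 δ)
    (ha : ∀ᶠ t in 𝓝 t₀, HasDerivAt a (a' t) t)
    (ha' : ContinuousAt a' t₀) (hfa : ∀ᶠ t in 𝓝 t₀, f t ≤ a t) (hag : ∀ᶠ t in 𝓝 t₀, a t < g t) :
    HasDerivAt (fun t => massPotential g μ ρ (a t, t))
      (ρ (a t₀, t₀) * (a' t₀ - u (a t₀, t₀))) t₀ := by
  have h1 := h.hasDerivAt_integral (tameOn_one _ _) (by simp) ht₀ ha ha' hfa hag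
  simp only [mul_one] at h1
  exact ((hμ t₀ ht₀).sub h1).congr_deriv (by ring)

/-- Passes the potential on to the adjacent layer: continuity of the mass flux across `f` makes
these values admissible boundary values there. -/
theorem fluxAlong_left (h : Layer δ M f f' g g' ρ u v) {μ : ℝ → ℝ}
    (hμ : FluxAlong δ g g' ρ u μ) :
    FluxAlong δ f f' ρ u (fun t => massPotential g μ ρ (f t, t)) := by
  intro t ht
  have htn : ∀ᶠ t in 𝓝 t, t ∈ Ioo 0 δ := Ioo_mem_nhds ht.1 ht.2
  exact h.hasDerivAt_potential_along hμ ht (htn.mono fun s hs => h.left.hasDerivAt s hs)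
    (h.left.continuousOn.continuousAt htn) (.of_forall fun _ => le_rfl)
    (htn.mono fun s hs => h.lt s hs)

theorem hasDerivAt_potential_snd (h : Layer δ M f f' g g' ρ u v) {μ : ℝ → ℝ}
    (hμ : FluxAlong δ g g' ρ u μ) {z : ℝ × ℝ} (hz : z ∈ openStrip δ f g) :
    HasDerivAt (fun t => massPotential g μ ρ (z.1, t)) (-(ρ z * u z)) z.2 := by
  have htn : Ioo 0 δ ∈ 𝓝 z.2 := Ioo_mem_nhds hz.1 hz.2.1
  have e : ∀ᶠ t in 𝓝 z.2, (z.1, t) ∈ openStrip δ f g :=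
    (by fun_prop : ContinuousAt (fun t : ℝ => (z.1, t)) z.2) (h.isOpen.mem_nhds hz)
  refine (h.hasDerivAt_potential_along hμ (a := fun _ => z.1) (a' := fun _ => 0) ⟨hz.1, hz.2.1⟩
    (.of_forall fun t => hasDerivAt_const _ _) continuousAt_const
    (e.mono fun t ht => ht.2.2.1.le) (e.mono fun t ht => ht.2.2.2)).congr_deriv ?_
  ring

theorem hasDerivAt_potential_fst (h : Layer δ M f f' g g' ρ u v) (μ : ℝ → ℝ)
    {z : ℝ × ℝ} (hz : z ∈ openStrip δ f g) :
    HasDerivAt (fun x => massPotential g μ ρ (x, z.2)) (ρ z) z.1 := by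
  have hc := h.continuousOn_slice h.tame_rho.cont ⟨hz.1, hz.2.1⟩
  have hI : Ioo (f z.2) (g z.2) ∈ 𝓝 z.1 := Ioo_mem_nhds hz.2.2.1 hz.2.2.2
  have h1 := intervalIntegral.integral_hasDerivAt_left (a := z.1) (b := g z.2)
    (f := fun y => ρ (y, z.2)) ?_
    ((hc.mono Ioo_subset_Icc_self).stronglyMeasurableAtFilter isOpen_Ioo _ ⟨hz.2.2.1, hz.2.2.2⟩)
    ((hc.mono Ioo_subset_Icc_self).continuousAt hI)
  · exact (h1.const_sub (μ z.2)).congr_deriv (neg_neg _)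
  · refine ContinuousOn.intervalIntegrable ?_
    rw [uIcc_of_le hz.2.2.2.le]
    exact hc.mono (Icc_subset_Icc_left hz.2.2.1.le)

/-- The partial derivatives `ρ` and `-ρ u` exist throughout the open strip and are continuous, hence
the potential is differentiable. -/
theorem hasFDerivAt_potential (h : Layer δ M f f' g g' ρ u v) {μ : ℝ → ℝ}
    (hμ : FluxAlong δ g g' ρ u μ) {z : ℝ × ℝ} (hz : z ∈ openStrip δ f g) :
    HasFDerivAt (massPotential g μ ρ)
      (ρ z • ContinuousLinearMap.fst ℝ ℝ ℝ - (ρ z * u z) • ContinuousLinearMap.snd ℝ ℝ ℝ) z := by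
  have hn := h.isOpen.mem_nhds hz
  have cρ := (h.tame_rho.differentiableAt h.isOpen hz).continuousAt
  have cu := (h.tame_u.differentiableAt h.isOpen hz).continuousAt
  have key := hasStrictFDerivAt_uncurry_coprod (𝕜 := ℝ) (u := z)
    (f := fun x t => massPotential g μ ρ (x, t))
    (f₁ := fun x t => ρ (x, t) • ContinuousLinearMap.id ℝ ℝ)
    (f₂ := fun x t => (-(ρ (x, t) * u (x, t))) • ContinuousLinearMap.id ℝ ℝ)
    ?_ ?_ (cρ.smul continuousAt_const) ((cρ.mul cu).neg.smul continuousAt_const)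
  · refine HasFDerivAt.congr_fderiv key.hasFDerivAt ?_
    ext <;> simp [Function.HasUncurry.uncurry]
  · filter_upwards [hn] with w hw
    rw [hasFDerivAt_iff_hasDerivAt]
    simpa [Function.HasUncurry.uncurry] using h.hasDerivAt_potential_fst μ hw
  · filter_upwards [hn] with w hw
    rw [hasFDerivAt_iff_hasDerivAt]
    simpa [Function.HasUncurry.uncurry] using h.hasDerivAt_potential_snd hμ hw

/-- Rescaling to `[0, 1]` fixes the domain of integration; the bound `ρ ≤ M` then allows dominated
convergence up to the boundary curves. -/
theorem continuousOn_potential (h : Layer δ M f f' g g' ρ u v) {μ : ℝ → ℝ}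
    (hμ : FluxAlong δ g g' ρ u μ) :
    ContinuousOn (massPotential g μ ρ) (closedStrip δ f g) := by
  have e : massPotential g μ ρ = fun z : ℝ × ℝ => μ z.2 -
      (∫ s in (0 : ℝ)..1, ρ (z.1 + (g z.2 - z.1) * s, z.2)) * (g z.2 - z.1) := by
    ext z
    rw [massPotential, ← intervalIntegral.integral_mul_const]
    exact congrArg _ (integral_between ρ (fun _ => z.1) g z.2)
  rw [e]
  intro z hz
  have htn : Ioo 0 δ ∈ 𝓝 z.2 := Ioo_mem_nhds hz.1 hz.2.1
  have hμc : ContinuousAt (fun z : ℝ × ℝ => μ z.2) z :=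
    ContinuousAt.comp (g := μ) (f := Prod.snd) (hμ z.2 ⟨hz.1, hz.2.1⟩).continuousAt
      continuousAt_snd
  have hgc : ContinuousAt (fun z : ℝ × ℝ => g z.2) z :=
    ContinuousAt.comp (g := g) (f := Prod.snd)
      (h.right.hasDerivAt z.2 ⟨hz.1, hz.2.1⟩).continuousAt continuousAt_snd
  refine hμc.continuousWithinAt.sub (ContinuousWithinAt.mul ?_
    (hgc.sub continuousAt_fst).continuousWithinAt)
  have hmem : ∀ w ∈ closedStrip δ f g, ∀ s ∈ Icc (0 : ℝ) 1,
      (w.1 + (g w.2 - w.1) * s, w.2) ∈ closedStrip δ f g := fun w hw s hs =>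
    between_mem_closed ⟨hw.1, hw.2.1⟩ hw.2.2.1 hw.2.2.2 hs
  have hI : uIoc (0 : ℝ) 1 = Ioc 0 1 := uIoc_of_le zero_le_one
  refine intervalIntegral.continuousWithinAt_of_dominated_interval (bound := fun _ => M)
    ?_ ?_ intervalIntegrable_const ?_
  · filter_upwards [self_mem_nhdsWithin] with w hw
    rw [hI]
    exact (h.tame_rho.cont.comp (by fun_prop) fun s hs =>
      hmem w hw s (Ioc_subset_Icc_self hs)).aestronglyMeasurable measurableSet_Ioc
  · filter_upwards [self_mem_nhdsWithin] with w hw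
    refine .of_forall fun s hs => ?_
    rw [hI] at hs
    have := hmem w hw s (Ioc_subset_Icc_self hs)
    rw [Real.norm_eq_abs, abs_of_pos (h.pos _ this)]
    exact h.rho_le _ this
  · refine .of_forall fun s hs => ?_
    rw [hI] at hs
    have hs' := Ioc_subset_Icc_self hs
    refine ContinuousWithinAt.comp (t := closedStrip δ f g)
      (f := fun w : ℝ × ℝ => (w.1 + (g w.2 - w.1) * s, w.2))
      (h.tame_rho.cont _ (hmem z hz s hs')) ?_ fun w hw => hmem w hw s hs'
    exact ((continuousAt_fst.add ((hgc.sub continuousAt_fst).mul continuousAt_const)).prodMk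
      continuousAt_snd).continuousWithinAt

theorem tameOn_potential (h : Layer δ M f f' g g' ρ u v) {μ : ℝ → ℝ}
    (hμ : FluxAlong δ g g' ρ u μ) :
    TameOn (openStrip δ f g) (closedStrip δ f g) (massPotential g μ ρ) where
  cont := h.continuousOn_potential hμ
  smooth := by
    have h1 : ContDiffOn ℝ (0 + 1) (massPotential g μ ρ) (openStrip δ f g) := by
      rw [contDiffOn_succ_iff_fderiv_of_isOpen h.isOpen]
      refine ⟨fun z hz => (h.hasFDerivAt_potential hμ hz).differentiableAt.differentiableWithinAt,
        by simp, ?_⟩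
      rw [contDiffOn_zero]
      refine ContinuousOn.congr ?_ fun z hz => (h.hasFDerivAt_potential hμ hz).fderiv
      exact (h.tame_rho.smooth.continuousOn.smul continuousOn_const).sub
        ((h.tame_rho.smooth.continuousOn.mul h.tame_u.smooth.continuousOn).smul
          continuousOn_const)
    simpa using h1
  bdd z hz := by
    refine ⟨(|ρ z| + 1) * ‖ContinuousLinearMap.fst ℝ ℝ ℝ‖ +
      (|ρ z| + 1) * (|u z| + 1) * ‖ContinuousLinearMap.snd ℝ ℝ ℝ‖, ?_⟩
    filter_upwards [self_mem_nhdsWithin,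
      h.tame_rho.eventually_abs_le (openStrip_subset _ _ _) hz,
      h.tame_u.eventually_abs_le (openStrip_subset _ _ _) hz] with w hw h1 h2
    rw [(h.hasFDerivAt_potential hμ hw).fderiv]
    refine (norm_sub_le _ _).trans ?_
    rw [norm_smul, norm_smul, norm_mul, Real.norm_eq_abs, Real.norm_eq_abs]
    gcongr

/-! ### The energy of the deviation `v - G(m)`. -/

/-- The deviation of the transported quantity from a function of the mass potential. -/
noncomputable def deviation (g μ G : ℝ → ℝ) (ρ v : ℝ × ℝ → ℝ) (z : ℝ × ℝ) : ℝ :=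
  v z - G (massPotential g μ ρ z)

theorem tameOn_deviation (h : Layer δ M f f' g g' ρ u v) {μ G : ℝ → ℝ} {I : Set ℝ}
    (hμ : FluxAlong δ g g' ρ u μ) (hI : IsOpen I) (hG : ContDiffOn ℝ 1 G I)
    (hm : MapsTo (massPotential g μ ρ) (closedStrip δ f g) I) :
    TameOn (openStrip δ f g) (closedStrip δ f g) (deviation g μ G ρ v) :=
  h.tame_v.sub ((h.tameOn_potential hμ).comp h.isOpen (openStrip_subset _ _ _) hI hG hm) h.isOpen

/-- The potential is itself transported, since `m_t + u m_x = -ρ u + u ρ = 0`; hence so is `v -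
G(m)`. -/
theorem deviation_transport (h : Layer δ M f f' g g' ρ u v) {μ G : ℝ → ℝ} {I : Set ℝ}
    (hμ : FluxAlong δ g g' ρ u μ) (hI : IsOpen I) (hG : ContDiffOn ℝ 1 G I)
    (hm : MapsTo (massPotential g μ ρ) (closedStrip δ f g) I) {z : ℝ × ℝ}
    (hz : z ∈ openStrip δ f g) :
    fderiv ℝ (deviation g μ G ρ v) z (0, 1) + u z * fderiv ℝ (deviation g μ G ρ v) z (1, 0) = 0 := by
  have hG' : DifferentiableAt ℝ G (massPotential g μ ρ z) :=
    (hG.contDiffAt (hI.mem_nhds (hm (openStrip_subset _ _ _ hz)))).differentiableAt one_ne_zero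
  have h1 := (h.tame_v.differentiableAt h.isOpen hz).hasFDerivAt.sub
    (hG'.hasDerivAt.comp_hasFDerivAt z (h.hasFDerivAt_potential hμ hz))
  have h2 : HasFDerivAt (deviation g μ G ρ v) _ z := h1
  rw [h2.fderiv]
  simp
  linear_combination h.transport z hz

theorem hasDerivAt_energy (h : Layer δ M f f' g g' ρ u v) {μ G : ℝ → ℝ} {I : Set ℝ}
    (hμ : FluxAlong δ g g' ρ u μ) (hI : IsOpen I) (hG : ContDiffOn ℝ 1 G I)
    (hm : MapsTo (massPotential g μ ρ) (closedStrip δ f g) I) {t : ℝ} (ht : t ∈ Ioo 0 δ) :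
    HasDerivAt (fun t => ∫ y in f t..g t,
        ρ (y, t) * (deviation g μ G ρ v (y, t) * deviation g μ G ρ v (y, t)))
      (ρ (g t, t) * (deviation g μ G ρ v (g t, t) * deviation g μ G ρ v (g t, t)) *
          (g' t - u (g t, t)) -
        ρ (f t, t) * (deviation g μ G ρ v (f t, t) * deviation g μ G ρ v (f t, t)) *
          (f' t - u (f t, t))) t := by
  have htn : ∀ᶠ t in 𝓝 t, t ∈ Ioo 0 δ := Ioo_mem_nhds ht.1 ht.2
  have hd := h.tameOn_deviation hμ hI hG hm
  refine h.hasDerivAt_integral (w := fun z => deviation g μ G ρ v z * deviation g μ G ρ v z)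
    (hd.mul hd h.isOpen (openStrip_subset _ _ _)) (fun z hz => ?_) ht
    (htn.mono fun s hs => h.left.hasDerivAt s hs)
    (h.left.continuousOn.continuousAt htn) (.of_forall fun _ => le_rfl)
    (htn.mono fun s hs => h.lt s hs)
  have hdz := hd.differentiableAt h.isOpen hz
  rw [fderiv_fun_mul hdz hdz]
  simp only [add_apply, smul_apply, smul_eq_mul]
  linear_combination 2 * deviation g μ G ρ v z * h.deviation_transport hμ hI hG hm hz

end Layer

/-- Dominated convergence for the integrands extended by zero. Convergence is not required at the
limiting endpoints, a null set. The case `a₀ = b₀` is allowed and describes a layer that collapses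
to a point. -/
theorem tendsto_integral_moving {l : Filter ℝ} [l.IsCountablyGenerated] {h : ℝ → ℝ → ℝ}
    {h₀ a b : ℝ → ℝ} {a₀ b₀ C : ℝ} (hab : ∀ᶠ t in l, a t ≤ b t) (hab₀ : a₀ ≤ b₀)
    (ha : Tendsto a l (𝓝 a₀)) (hb : Tendsto b l (𝓝 b₀))
    (hc : ∀ᶠ t in l, ContinuousOn (h t) (Icc (a t) (b t)))
    (hC : ∀ᶠ t in l, ∀ y ∈ Icc (a t) (b t), |h t y| ≤ C)
    (hlim : ∀ y ∈ Ioo a₀ b₀, Tendsto (fun t => h t y) l (𝓝 (h₀ y))) :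
    Tendsto (fun t => ∫ y in a t..b t, h t y) l (𝓝 (∫ y in a₀..b₀, h₀ y)) := by
  have e : ∀ᶠ t in l, ∫ y, (Ioc (a t) (b t)).indicator (h t) y = ∫ y in a t..b t, h t y := by
    filter_upwards [hab] with t ht
    rw [integral_indicator measurableSet_Ioc, intervalIntegral.integral_of_le ht]
  have e₀ : ∫ y, (Ioc a₀ b₀).indicator h₀ y = ∫ y in a₀..b₀, h₀ y := by
    rw [integral_indicator measurableSet_Ioc, intervalIntegral.integral_of_le hab₀]
  rw [← e₀]
  refine Tendsto.congr' e ?_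
  refine tendsto_integral_filter_of_dominated_convergence
    ((Icc (a₀ - 1) (b₀ + 1)).indicator fun _ => |C|) ?_ ?_ ?_ ?_
  · filter_upwards [hc] with t ht
    rw [aestronglyMeasurable_indicator_iff measurableSet_Ioc]
    exact (ht.mono Ioc_subset_Icc_self).aestronglyMeasurable measurableSet_Ioc
  · filter_upwards [hC, ha.eventually (lt_mem_nhds (sub_one_lt a₀)),
      hb.eventually (gt_mem_nhds (lt_add_one b₀))] with t h1 h2 h3
    refine .of_forall fun y => ?_
    by_cases hy : y ∈ Ioc (a t) (b t)
    · have hy' : y ∈ Icc (a₀ - 1) (b₀ + 1) := ⟨by linarith [hy.1], by linarith [hy.2]⟩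
      rw [indicator_of_mem hy, indicator_of_mem hy']
      exact (h1 y (Ioc_subset_Icc_self hy)).trans (le_abs_self C)
    · rw [indicator_of_notMem hy, norm_zero]
      exact indicator_nonneg (fun _ _ => abs_nonneg C) y
  · rw [integrable_indicator_iff measurableSet_Icc]
    exact integrableOn_const (by simp)
  · have hne : ∀ᵐ y : ℝ, y ≠ a₀ ∧ y ≠ b₀ := by
      have h1 : ∀ c : ℝ, ∀ᵐ y : ℝ, y ≠ c := fun c => by simp [ae_iff]
      exact (h1 a₀).and (h1 b₀)
    filter_upwards [hne] with y hy
    by_cases hy0 : y ∈ Ioc a₀ b₀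
    · have hy1 : y < b₀ := lt_of_le_of_ne hy0.2 hy.2
      rw [indicator_of_mem hy0]
      refine (hlim y ⟨hy0.1, hy1⟩).congr' ?_
      filter_upwards [ha.eventually (gt_mem_nhds hy0.1), hb.eventually (lt_mem_nhds hy1)]
        with t h1 h2
      have hy2 : y ∈ Ioc (a t) (b t) := ⟨h1, h2.le⟩
      rw [indicator_of_mem hy2]
    · rw [indicator_of_notMem hy0]
      refine tendsto_const_nhds.congr' ?_
      rcases lt_or_gt_of_ne hy.1 with h1 | h1
      · filter_upwards [ha.eventually (lt_mem_nhds h1)] with t h2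
        rw [indicator_of_notMem fun h3 => absurd h3.1 h2.not_gt]
      · have h2 : b₀ < y := lt_of_not_ge fun h2 => hy0 ⟨h1, h2⟩
        filter_upwards [hb.eventually (gt_mem_nhds h2)] with t h3
        rw [indicator_of_notMem fun h4 => absurd h4.2 h3.not_ge]

theorem massPotential_self (g μ : ℝ → ℝ) (ρ : ℝ × ℝ → ℝ) (t : ℝ) :
    massPotential g μ ρ (g t, t) = μ t := by
  simp [massPotential]

/-- The energy density of the deviation. -/
noncomputable def energyDensity (g μ G : ℝ → ℝ) (ρ v : ℝ × ℝ → ℝ) (z : ℝ × ℝ) : ℝ :=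
  ρ z * (Layer.deviation g μ G ρ v z * Layer.deviation g μ G ρ v z)

namespace Layer

variable {δ M : ℝ} {f f' g g' : ℝ → ℝ} {ρ u v : ℝ × ℝ → ℝ}

theorem left_mem (h : Layer δ M f f' g g' ρ u v) {t : ℝ} (ht : t ∈ Ioo 0 δ) :
    (f t, t) ∈ closedStrip δ f g := ⟨ht.1, ht.2, le_rfl, (h.lt t ht).le⟩

theorem energyDensity_nonneg (h : Layer δ M f f' g g' ρ u v) (μ G : ℝ → ℝ) {z : ℝ × ℝ}
    (hz : z ∈ closedStrip δ f g) : 0 ≤ energyDensity g μ G ρ v z :=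
  mul_nonneg (h.pos z hz).le (mul_self_nonneg _)

theorem energy_nonneg (h : Layer δ M f f' g g' ρ u v) (μ G : ℝ → ℝ) {t : ℝ} (ht : t ∈ Ioo 0 δ) :
    0 ≤ ∫ y in f t..g t, energyDensity g μ G ρ v (y, t) :=
  intervalIntegral.integral_nonneg (h.lt t ht).le fun _ hy =>
    h.energyDensity_nonneg μ G ⟨ht.1, ht.2, hy.1, hy.2⟩

theorem energyDensity_le (h : Layer δ M f f' g g' ρ u v) {μ G : ℝ → ℝ} {I : Set ℝ}
    (hGM : ∀ m ∈ I, |G m| ≤ M) (hm : MapsTo (massPotential g μ ρ) (closedStrip δ f g) I)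
    {z : ℝ × ℝ} (hz : z ∈ closedStrip δ f g) :
    |energyDensity g μ G ρ v z| ≤ M * ((M + M) * (M + M)) := by
  have h1 : |deviation g μ G ρ v z| ≤ M + M :=
    (abs_sub _ _).trans (add_le_add (h.v_le z hz) (hGM _ (hm hz)))
  have h0 := h.pos z hz
  have h2 := h.rho_le z hz
  have hM : 0 ≤ M := h0.le.trans h2
  rw [energyDensity, abs_mul, abs_mul, abs_of_pos h0]
  gcongr

theorem continuousOn_energyDensity (h : Layer δ M f f' g g' ρ u v) {μ G : ℝ → ℝ} {I : Set ℝ}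
    (hμ : FluxAlong δ g g' ρ u μ) (hI : IsOpen I) (hG : ContDiffOn ℝ 1 G I)
    (hm : MapsTo (massPotential g μ ρ) (closedStrip δ f g) I) :
    ContinuousOn (energyDensity g μ G ρ v) (closedStrip δ f g) :=
  h.tame_rho.cont.mul ((h.tameOn_deviation hμ hI hG hm).cont.mul
    (h.tameOn_deviation hμ hI hG hm).cont)

theorem tendsto_energy (h : Layer δ M f f' g g' ρ u v) (hδ : 0 < δ) {μ G : ℝ → ℝ} {I : Set ℝ}
    (hμ : FluxAlong δ g g' ρ u μ) (hI : IsOpen I) (hG : ContDiffOn ℝ 1 G I)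
    (hGM : ∀ m ∈ I, |G m| ≤ M)
    (hm : MapsTo (massPotential g μ ρ) (closedStrip δ f g) I) {a b : ℝ} (hab : a ≤ b)
    (hf : Tendsto f (𝓝[>] 0) (𝓝 a)) (hg : Tendsto g (𝓝[>] 0) (𝓝 b))
    (hlim : ∀ y ∈ Ioo a b,
      Tendsto (fun t => energyDensity g μ G ρ v (y, t)) (𝓝[>] 0) (𝓝 0)) :
    Tendsto (fun t => ∫ y in f t..g t, energyDensity g μ G ρ v (y, t)) (𝓝[>] 0) (𝓝 0) := by
  have htn : ∀ᶠ t : ℝ in 𝓝[>] 0, t ∈ Ioo 0 δ := Ioo_mem_nhdsGT hδ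
  have := tendsto_integral_moving (h := fun t y => energyDensity g μ G ρ v (y, t))
    (h₀ := fun _ => 0) (C := M * ((M + M) * (M + M))) (htn.mono fun t ht => (h.lt t ht).le)
    hab hf hg
    (htn.mono fun t ht => h.continuousOn_slice (h.continuousOn_energyDensity hμ hI hG hm) ht)
    (htn.mono fun t ht y hy => h.energyDensity_le hGM hm ⟨ht.1, ht.2, hy.1, hy.2⟩) hlim
  simpa using this

/-- A continuous nonnegative density that is positive at one point of the slice, possibly an
endpoint, has positive integral. -/
theorem deviation_eq_zero (h : Layer δ M f f' g g' ρ u v) {μ G : ℝ → ℝ} {I : Set ℝ}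
    (hμ : FluxAlong δ g g' ρ u μ) (hI : IsOpen I) (hG : ContDiffOn ℝ 1 G I)
    (hm : MapsTo (massPotential g μ ρ) (closedStrip δ f g) I) {z : ℝ × ℝ}
    (hz : z ∈ closedStrip δ f g)
    (h0 : ∫ y in f z.2..g z.2, energyDensity g μ G ρ v (y, z.2) ≤ 0) :
    v z = G (massPotential g μ ρ z) := by
  by_contra hne
  have hd : deviation g μ G ρ v z ≠ 0 := sub_ne_zero.2 hne
  have ht : z.2 ∈ Ioo 0 δ := ⟨hz.1, hz.2.1⟩
  refine h0.not_gt (intervalIntegral.integral_pos (h.lt _ ht)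
    (h.continuousOn_slice (h.continuousOn_energyDensity hμ hI hG hm) ht)
    (fun y hy => h.energyDensity_nonneg μ G ⟨ht.1, ht.2, hy.1.le, hy.2⟩)
    ⟨z.1, ⟨hz.2.2.1, hz.2.2.2⟩, ?_⟩)
  exact mul_pos (h.pos z hz) (mul_self_pos.2 hd)

/-- At a curve across which the transported quantity, the mass potential and the mass flux are
continuous, the energy flux is continuous. -/
theorem energy_flux_eq {g μ μ₂ G : ℝ → ℝ} {k : ℝ → ℝ} {ρ ρ₂ v v₂ : ℝ × ℝ → ℝ} {t j j₂ : ℝ}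
    (hv : v (k t, t) = v₂ (k t, t)) (hj : ρ (k t, t) * j = ρ₂ (k t, t) * j₂)
    (hμ : μ t = massPotential g μ₂ ρ₂ (k t, t)) :
    ρ (k t, t) * (deviation k μ G ρ v (k t, t) * deviation k μ G ρ v (k t, t)) * j =
      ρ₂ (k t, t) * (deviation g μ₂ G ρ₂ v₂ (k t, t) * deviation g μ₂ G ρ₂ v₂ (k t, t)) * j₂ := by
  have h1 : deviation k μ G ρ v (k t, t) = deviation g μ₂ G ρ₂ v₂ (k t, t) := by
    rw [deviation, deviation, massPotential_self, hv, hμ]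
  rw [h1]
  linear_combination (deviation g μ₂ G ρ₂ v₂ (k t, t)) ^ 2 * hj

/-- In three adjacent layers, the last one bounded by a particle path issuing from the origin,
the transported quantity is determined by its initial values. -/
theorem hasDerivAt_of_initial {b η : ℝ} {y₀ y₀' y₁ y₁' y₂ y₂' y₃ y₃' : ℝ → ℝ}
    {ρA uA vA ρB uB vB ρC uC vC : ℝ × ℝ → ℝ} (hδ : 0 < δ) (hb : 0 < b)
    (A : Layer δ M y₀ y₀' y₁ y₁' ρA uA vA) (B : Layer δ M y₁ y₁' y₂ y₂' ρB uB vB)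
    (C : Layer δ M y₂ y₂' y₃ y₃' ρC uC vC)
    (jump₁ : ∀ t ∈ Ioo 0 δ, vA (y₁ t, t) = vB (y₁ t, t) ∧
      ρA (y₁ t, t) * (y₁' t - uA (y₁ t, t)) = ρB (y₁ t, t) * (y₁' t - uB (y₁ t, t)))
    (jump₂ : ∀ t ∈ Ioo 0 δ, vB (y₂ t, t) = vC (y₂ t, t) ∧
      ρB (y₂ t, t) * (y₂' t - uB (y₂ t, t)) = ρC (y₂ t, t) * (y₂' t - uC (y₂ t, t)))
    (contact : ∀ t ∈ Ioo 0 δ, y₃' t = uC (y₃ t, t))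
    (inflow : ∀ t ∈ Ioo 0 δ, uA (y₀ t, t) ≤ y₀' t)
    (lim₀ : Tendsto y₀ (𝓝[>] 0) (𝓝 (-b))) (lim₁ : Tendsto y₁ (𝓝[>] 0) (𝓝 0))
    (lim₂ : Tendsto y₂ (𝓝[>] 0) (𝓝 0)) (lim₃ : Tendsto y₃ (𝓝[>] 0) (𝓝 0))
    {ρ₀ v₀ G : ℝ → ℝ}
    (init_rho : ∀ y ∈ Ioo (-b) 0, Tendsto (fun t => ρA (y, t)) (𝓝[>] 0) (𝓝 (ρ₀ y)))
    (init_v : ∀ y ∈ Ioo (-b) 0, Tendsto (fun t => vA (y, t)) (𝓝[>] 0) (𝓝 (v₀ y)))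
    (hG : ContDiffOn ℝ 1 G (Ioo (-η) η)) (hGM : ∀ m ∈ Ioo (-η) η, |G m| ≤ M)
    (width : ∀ t ∈ Ioo 0 δ, M * (y₃ t - y₀ t) < η)
    (hG₀ : ∀ y ∈ Ioo (-b) 0, -(∫ x in y..0, ρ₀ x) ∈ Ioo (-η) η ∧
      v₀ y = G (-(∫ x in y..0, ρ₀ x)))
    {z : ℝ × ℝ} (hz : z ∈ openStrip δ y₂ y₃) :
    ∃ m, |m| ≤ M * (y₃ z.2 - z.1) ∧
      HasDerivAt (fun t => vC (z.1, t)) (deriv G m * -(ρC z * uC z)) z.2 := by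
  have htn : ∀ᶠ t : ℝ in 𝓝[>] 0, t ∈ Ioo 0 δ := Ioo_mem_nhdsGT hδ
  have hzK := openStrip_subset _ _ _ hz
  have hM : 0 ≤ M := (C.pos z hzK).le.trans (C.rho_le z hzK)
  -- The contact is a particle path, so no mass crosses it and the constant zero is a valid
  -- potential on it. The values on the other curves are then forced layer by layer.
  set μC : ℝ → ℝ := fun _ => 0 with hμC
  set μB : ℝ → ℝ := fun t => massPotential y₃ μC ρC (y₂ t, t) with hμB
  set μA : ℝ → ℝ := fun t => massPotential y₂ μB ρB (y₁ t, t) with hμA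
  have FC : FluxAlong δ y₃ y₃' ρC uC μC := fun t ht =>
    (hasDerivAt_const t (0 : ℝ)).congr_deriv (by rw [contact t ht]; ring)
  have FB : FluxAlong δ y₂ y₂' ρB uB μB := fun t ht =>
    (C.fluxAlong_left FC t ht).congr_deriv (jump₂ t ht).2.symm
  have FA : FluxAlong δ y₁ y₁' ρA uA μA := fun t ht =>
    (B.fluxAlong_left FB t ht).congr_deriv (jump₁ t ht).2.symm
  have bC : ∀ z ∈ closedStrip δ y₂ y₃, |massPotential y₃ μC ρC z| ≤ M * (y₃ z.2 - z.1) :=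
    fun z hz => C.abs_potential_le hz (by simp [hμC])
  have bB : ∀ z ∈ closedStrip δ y₁ y₂, |massPotential y₂ μB ρB z| ≤ M * (y₃ z.2 - z.1) :=
    fun z hz => B.abs_potential_le hz (bC _ (C.left_mem ⟨hz.1, hz.2.1⟩))
  have bA : ∀ z ∈ closedStrip δ y₀ y₁, |massPotential y₁ μA ρA z| ≤ M * (y₃ z.2 - z.1) :=
    fun z hz => A.abs_potential_le hz (bB _ (B.left_mem ⟨hz.1, hz.2.1⟩))
  have small : ∀ t ∈ Ioo 0 δ, ∀ x, y₀ t ≤ x → ∀ m, |m| ≤ M * (y₃ t - x) → m ∈ Ioo (-η) η := by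
    intro t ht x hx m hm
    have h1 : M * (y₃ t - x) ≤ M * (y₃ t - y₀ t) := by gcongr
    exact abs_lt.1 ((hm.trans h1).trans_lt (width t ht))
  have mC : MapsTo (massPotential y₃ μC ρC) (closedStrip δ y₂ y₃) (Ioo (-η) η) := fun z hz =>
    have ht : z.2 ∈ Ioo 0 δ := ⟨hz.1, hz.2.1⟩
    small z.2 ht z.1 (((A.lt _ ht).trans (B.lt _ ht)).le.trans hz.2.2.1) _ (bC z hz)
  have mB : MapsTo (massPotential y₂ μB ρB) (closedStrip δ y₁ y₂) (Ioo (-η) η) := fun z hz =>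
    have ht : z.2 ∈ Ioo 0 δ := ⟨hz.1, hz.2.1⟩
    small z.2 ht z.1 ((A.lt _ ht).le.trans hz.2.2.1) _ (bB z hz)
  have mA : MapsTo (massPotential y₁ μA ρA) (closedStrip δ y₀ y₁) (Ioo (-η) η) := fun z hz =>
    small z.2 ⟨hz.1, hz.2.1⟩ z.1 hz.2.2.1 _ (bA z hz)
  -- The mass between the curves `y₁` and `y₃` vanishes as they meet at the origin. In the limit the
  -- potential in the outer layer is therefore the initial mass coordinate measured from `x = 0`.
  have hμA0 : Tendsto μA (𝓝[>] 0) (𝓝 0) := by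
    have h1 : Tendsto (fun t => M * (y₃ t - y₁ t)) (𝓝[>] 0) (𝓝 0) := by
      simpa using (lim₃.sub lim₁).const_mul M
    refine squeeze_zero_norm' ?_ h1
    filter_upwards [htn] with t ht
    exact bB _ (B.left_mem ht)
  have limA : Tendsto (fun t => ∫ y in y₀ t..y₁ t, energyDensity y₁ μA G ρA vA (y, t))
      (𝓝[>] 0) (𝓝 0) := by
    refine A.tendsto_energy hδ FA isOpen_Ioo hG hGM mA (neg_nonpos.2 hb.le) lim₀ lim₁ ?_
    intro y hy
    obtain ⟨hy1, hy2⟩ := hG₀ y hy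
    have e : ∀ᶠ t in 𝓝[>] 0, t ∈ Ioo 0 δ ∧ y₀ t < y ∧ y < y₁ t :=
      htn.and ((lim₀.eventually (gt_mem_nhds hy.1)).and (lim₁.eventually (lt_mem_nhds hy.2)))
    have h1 : Tendsto (fun t => ∫ x in y..y₁ t, ρA (x, t)) (𝓝[>] 0) (𝓝 (∫ x in y..0, ρ₀ x)) := by
      refine tendsto_integral_moving (C := M) (e.mono fun t ht => ht.2.2.le) hy.2.le
        tendsto_const_nhds lim₁ (e.mono fun t ht => ?_) (e.mono fun t ht x hx => ?_)
        fun x hx => init_rho x ⟨hy.1.trans hx.1, hx.2⟩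
      · exact (A.continuousOn_slice A.tame_rho.cont ht.1).mono
          (Icc_subset_Icc_left ht.2.1.le)
      · have hx' : (x, t) ∈ closedStrip δ y₀ y₁ :=
          ⟨ht.1.1, ht.1.2, ht.2.1.le.trans hx.1, hx.2⟩
        rw [abs_of_pos (A.pos _ hx')]
        exact A.rho_le _ hx'
    have h2 : Tendsto (fun t => massPotential y₁ μA ρA (y, t)) (𝓝[>] 0)
        (𝓝 (-(∫ x in y..0, ρ₀ x))) := by
      simpa [massPotential] using hμA0.sub h1
    have h3 := (hG.continuousOn.continuousAt (isOpen_Ioo.mem_nhds hy1)).tendsto.comp h2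
    have h4 := (init_v y hy).sub h3
    rw [hy2, sub_self] at h4
    simpa [energyDensity, deviation] using (init_rho y hy).mul (h4.mul h4)
  -- Both ends tend to `0`, so the pointwise hypothesis is vacuous and boundedness suffices. No
  -- information on the limiting profile of the fan is needed.
  have limB : Tendsto (fun t => ∫ y in y₁ t..y₂ t, energyDensity y₂ μB G ρB vB (y, t))
      (𝓝[>] 0) (𝓝 0) :=
    B.tendsto_energy hδ FB isOpen_Ioo hG hGM mB le_rfl lim₁ lim₂ (by simp)
  have limC : Tendsto (fun t => ∫ y in y₂ t..y₃ t, energyDensity y₃ μC G ρC vC (y, t))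
      (𝓝[>] 0) (𝓝 0) :=
    C.tendsto_energy hδ FC isOpen_Ioo hG hGM mC le_rfl lim₂ lim₃ (by simp)
  set E : ℝ → ℝ := fun t => (∫ y in y₀ t..y₁ t, energyDensity y₁ μA G ρA vA (y, t)) +
    (∫ y in y₁ t..y₂ t, energyDensity y₂ μB G ρB vB (y, t)) +
    ∫ y in y₂ t..y₃ t, energyDensity y₃ μC G ρC vC (y, t) with hE
  have hE0 : Tendsto E (𝓝[>] 0) (𝓝 0) := by simpa using (limA.add limB).add limC
  have hE' : ∀ t ∈ Ioo 0 δ, ∃ d ≤ 0, HasDerivAt E d t := by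
    intro t ht
    refine ⟨_, ?_, ((A.hasDerivAt_energy FA isOpen_Ioo hG mA ht).add
      (B.hasDerivAt_energy FB isOpen_Ioo hG mB ht)).add
      (C.hasDerivAt_energy FC isOpen_Ioo hG mC ht)⟩
    have h1 := energy_flux_eq (G := G) (μ := μA) (g := y₂) (μ₂ := μB) (jump₁ t ht).1
      (jump₁ t ht).2 rfl
    have h2 := energy_flux_eq (G := G) (μ := μB) (g := y₃) (μ₂ := μC) (jump₂ t ht).1
      (jump₂ t ht).2 rfl
    -- The left boundary is at least as fast as the fluid, so its flux can only decrease the energy.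
    -- The fluxes at `y₁` and `y₂` cancel, and the one at the contact vanishes.
    have h3 : 0 ≤ ρA (y₀ t, t) * (deviation y₁ μA G ρA vA (y₀ t, t) *
        deviation y₁ μA G ρA vA (y₀ t, t)) * (y₀' t - uA (y₀ t, t)) :=
      mul_nonneg (A.energyDensity_nonneg μA G (A.left_mem ht)) (sub_nonneg.2 (inflow t ht))
    have h4 : y₃' t - uC (y₃ t, t) = 0 := sub_eq_zero.2 (contact t ht)
    rw [h1, h2, h4, mul_zero]
    linarith
  have hanti : AntitoneOn E (Ioo 0 δ) := by
    refine antitoneOn_of_deriv_nonpos (convex_Ioo 0 δ) (fun t ht => ?_) (fun t ht => ?_)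
      fun t ht => ?_
    · obtain ⟨d, -, hd⟩ := hE' t ht
      exact hd.continuousAt.continuousWithinAt
    · rw [interior_Ioo] at ht
      obtain ⟨d, -, hd⟩ := hE' t ht
      exact hd.differentiableAt.differentiableWithinAt
    · rw [interior_Ioo] at ht
      obtain ⟨d, hd0, hd⟩ := hE' t ht
      rwa [hd.deriv]
  have hEle : ∀ t ∈ Ioo 0 δ, E t ≤ 0 := by
    intro t ht
    refine ge_of_tendsto hE0 ?_
    filter_upwards [Ioo_mem_nhdsGT ht.1] with s hs
    exact hanti ⟨hs.1, hs.2.trans ht.2⟩ ht hs.2.le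
  have hv : ∀ w ∈ openStrip δ y₂ y₃, vC w = G (massPotential y₃ μC ρC w) := by
    intro w hw
    have ht : w.2 ∈ Ioo 0 δ := ⟨hw.1, hw.2.1⟩
    refine C.deviation_eq_zero FC isOpen_Ioo hG mC (openStrip_subset _ _ _ hw) ?_
    have h1 := hEle _ ht
    have h2 := A.energy_nonneg μA G ht
    have h3 := B.energy_nonneg μB G ht
    simp only [hE] at h1
    linarith
  refine ⟨massPotential y₃ μC ρC z, bC z hzK, ?_⟩
  have hG' : DifferentiableAt ℝ G (massPotential y₃ μC ρC z) :=
    (hG.contDiffAt (isOpen_Ioo.mem_nhds (mC hzK))).differentiableAt one_ne_zero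
  have key := HasDerivAt.comp (h := fun t => massPotential y₃ μC ρC (z.1, t)) (h₂ := G) z.2
    hG'.hasDerivAt (C.hasDerivAt_potential_snd FC hz)
  refine key.congr_of_eventuallyEq ?_
  have e : ∀ᶠ t in 𝓝 z.2, (z.1, t) ∈ openStrip δ y₂ y₃ :=
    (by fun_prop : ContinuousAt (fun t : ℝ => (z.1, t)) z.2) (C.isOpen.mem_nhds hz)
  filter_upwards [e] with t ht
  exact hv _ ht

end Layer

/-! ### The function `G` for linear conserved data. -/

/-- The function expressing the transported quantity in terms of the mass coordinate, when the
density and the partial density of the quantity are initially linear. -/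
theorem exists_function_of_mass {ρ₀ : ℝ} (hρ : 0 < ρ₀) (d w d₂ : ℝ) :
    ∃ (G : ℝ → ℝ) (η b C : ℝ), 0 < η ∧ 0 < b ∧ ContDiffOn ℝ 1 G (Ioo (-η) η) ∧
      (∀ m ∈ Ioo (-η) η, |G m| ≤ C) ∧
      (∀ y ∈ Ioo (-b) 0, -(∫ x in y..0, (ρ₀ + x * d)) ∈ Ioo (-η) η ∧
        (w + y * d₂) / (ρ₀ + y * d) = G (-(∫ x in y..0, (ρ₀ + x * d)))) ∧
      deriv G 0 * ρ₀ = deriv (fun x => (w + x * d₂) / (ρ₀ + x * d)) 0 := by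
  -- The mass coordinate is `m = ρ₀ y + d y² / 2`, whence `(ρ₀ + y d)² = ρ₀² + 2 d m`, and `S` is
  -- the density as a function of `m`. The root `y = 2 m / (ρ₀ + S m)` is written in rationalised
  -- form so that `d = 0` needs no separate case.
  set S : ℝ → ℝ := fun m => Real.sqrt (ρ₀ ^ 2 + 2 * d * m) with hS
  set G : ℝ → ℝ := fun m => (w + 2 * m / (ρ₀ + S m) * d₂) / S m with hGdef
  -- Chosen so that `|2 d m| ≤ ρ₀² / 2`, which keeps the radicand positive.
  set η : ℝ := ρ₀ ^ 2 / (4 * (|d| + 1)) with hη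
  have hη0 : 0 < η := by positivity
  have hP : ∀ m ∈ Ioo (-η) η, 0 < ρ₀ ^ 2 + 2 * d * m := by
    intro m hm
    have h1 : |d * m| ≤ (|d| + 1) * η := by
      rw [abs_mul]
      exact mul_le_mul (by linarith) (abs_lt.2 hm).le (abs_nonneg _) (by positivity)
    have h2 : (|d| + 1) * η = ρ₀ ^ 2 / 4 := by rw [hη]; field_simp
    have h3 := neg_le_of_abs_le h1
    have h4 : 0 < ρ₀ ^ 2 := by positivity
    linarith
  have hSpos : ∀ m ∈ Ioo (-η) η, 0 < S m := fun m hm => Real.sqrt_pos.2 (hP m hm)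
  have hScd : ContDiffOn ℝ 1 S (Ioo (-η) η) :=
    ContDiffOn.sqrt (by fun_prop) fun m hm => (hP m hm).ne'
  have hGcd : ContDiffOn ℝ 1 G (Ioo (-η) η) := by
    refine ContDiffOn.div (contDiffOn_const.add ((ContDiffOn.div (by fun_prop)
      (contDiffOn_const.add hScd) fun m hm => ?_).mul contDiffOn_const)) hScd
      fun m hm => (hSpos m hm).ne'
    have := hSpos m hm
    positivity
  have hsub : Icc (-(η / 2)) (η / 2) ⊆ Ioo (-η) η := fun m hm =>
    ⟨by linarith [hm.1], by linarith [hm.2]⟩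
  have hsub' : Ioo (-(η / 2)) (η / 2) ⊆ Ioo (-η) η := Ioo_subset_Icc_self.trans hsub
  obtain ⟨C, hC⟩ := isCompact_Icc.exists_bound_of_continuousOn (hGcd.continuousOn.mono hsub)
  set μ : ℝ → ℝ := fun y => ρ₀ * y + d * y ^ 2 / 2 with hμ
  have hint : ∀ y, -(∫ x in y..0, (ρ₀ + x * d)) = μ y := by
    intro y
    rw [intervalIntegral.integral_add (by simp) (by apply Continuous.intervalIntegrable; fun_prop),
      intervalIntegral.integral_mul_const]
    simp [hμ]
    ring
  have hμ0 : μ 0 = 0 := by simp [hμ]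
  have e : ∀ᶠ y in 𝓝 (0 : ℝ), μ y ∈ Ioo (-(η / 2)) (η / 2) ∧ 0 < ρ₀ + y * d := by
    refine Filter.Eventually.and ?_ ?_
    · have hc : ContinuousAt μ 0 := by simp only [hμ]; fun_prop
      refine hc (Ioo_mem_nhds ?_ ?_) <;> rw [hμ0] <;> linarith
    · have hc : ContinuousAt (fun y : ℝ => ρ₀ + y * d) 0 := by fun_prop
      exact hc.eventually (lt_mem_nhds (by simpa using hρ))
  have hval : ∀ y, 0 < ρ₀ + y * d → (w + y * d₂) / (ρ₀ + y * d) = G (μ y) := by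
    intro y hy
    have h1 : S (μ y) = ρ₀ + y * d := by
      rw [hS, ← Real.sqrt_sq hy.le]
      simp only [hμ]
      congr 1
      ring
    have h2 : 2 * μ y / (ρ₀ + S (μ y)) = y := by
      have h3 : ρ₀ + (ρ₀ + y * d) ≠ 0 := by positivity
      rw [h1, div_eq_iff h3]
      simp only [hμ]
      ring
    simp only [hGdef]
    rw [h2, h1]
  obtain ⟨b, hb, hball⟩ := Metric.eventually_nhds_iff.1 e
  -- The radius is halved so that `G` is bounded, by compactness of the smaller closed interval.
  refine ⟨G, η / 2, b, C, by positivity, hb, hGcd.mono hsub', fun m hm => ?_, fun y hy => ?_, ?_⟩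
  · simpa using hC m (Ioo_subset_Icc_self hm)
  · rw [hint]
    have := hball (y := y) (by
      rw [Real.dist_eq, sub_zero, abs_lt]; exact ⟨hy.1, hy.2.trans hb⟩)
    exact ⟨this.1, hval y this.2⟩
  · have h0 : (0 : ℝ) ∈ Ioo (-η) η := ⟨by linarith, hη0⟩
    have hG' : HasDerivAt G (deriv G 0) (μ 0) := by
      rw [hμ0]
      exact ((hGcd.contDiffAt (isOpen_Ioo.mem_nhds h0)).differentiableAt one_ne_zero).hasDerivAt
    have hμ' : HasDerivAt μ ρ₀ 0 := by
      have := ((hasDerivAt_id (0 : ℝ)).const_mul ρ₀).add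
        ((((hasDerivAt_id (0 : ℝ)).pow 2).const_mul d).div_const 2)
      exact this.congr_deriv (by simp)
    have h1 : HasDerivAt (fun x => (w + x * d₂) / (ρ₀ + x * d)) (deriv G 0 * ρ₀) 0 :=
      (hG'.comp 0 hμ').congr_of_eventuallyEq (e.mono fun y hy => hval y hy.2)
    exact h1.deriv.symm

/-! ### The time derivative on the axis from three adjacent patches. -/

namespace Patch

variable {δ : ℝ} {f f' g g' : ℝ → ℝ} {ρ u v : ℝ × ℝ → ℝ}

theorem restrict (h : Patch δ f f' g g' ρ u v) {δ₁ : ℝ} (hδ : δ₁ ≤ δ) {k k' : ℝ → ℝ}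
    (hk : IsC1Curve δ₁ k k') (hfk : ∀ t ∈ Ioo 0 δ₁, f t ≤ k t) (hkg : ∀ t ∈ Ioo 0 δ₁, k t < g t) :
    Patch δ₁ k k' g g' ρ u v := by
  have hs : Ioo 0 δ₁ ⊆ Ioo 0 δ := Ioo_subset_Ioo_right hδ
  have hK : closedStrip δ₁ k g ⊆ closedStrip δ f g := fun z hz =>
    ⟨hz.1, hz.2.1.trans_le hδ, (hfk _ ⟨hz.1, hz.2.1⟩).trans hz.2.2.1, hz.2.2.2⟩
  have hΩ : openStrip δ₁ k g ⊆ openStrip δ f g := fun z hz =>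
    ⟨hz.1, hz.2.1.trans_le hδ, (hfk _ ⟨hz.1, hz.2.1⟩).trans_lt hz.2.2.1, hz.2.2.2⟩
  exact
    { lt := hkg
      left := hk
      right := ⟨fun t ht => h.right.hasDerivAt t (hs ht), h.right.continuousOn.mono hs⟩
      tame_rho := h.tame_rho.mono hΩ hK
      tame_u := h.tame_u.mono hΩ hK
      tame_v := h.tame_v.mono hΩ hK
      pos := fun z hz => h.pos z (hK hz)
      mass := fun z hz => h.mass z (hΩ hz)
      transport := fun z hz => h.transport z (hΩ hz) }

theorem shorten (h : Patch δ f f' g g' ρ u v) {δ₁ : ℝ} (hδ : δ₁ ≤ δ) :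
    Patch δ₁ f f' g g' ρ u v :=
  h.restrict hδ ⟨fun t ht => h.left.hasDerivAt t (Ioo_subset_Ioo_right hδ ht),
    h.left.continuousOn.mono (Ioo_subset_Ioo_right hδ)⟩ (fun _ _ => le_rfl)
    fun t ht => h.lt t (Ioo_subset_Ioo_right hδ ht)

end Patch

/-- `ρ`, `u` and `v` are bounded near the origin in `K`. -/
def BoundedNear (K : Set (ℝ × ℝ)) (ρ u v : ℝ × ℝ → ℝ) : Prop :=
  ∃ η > 0, ∃ B, ∀ z ∈ K, |z.1| < η → |z.2| < η → |ρ z| ≤ B ∧ |u z| ≤ B ∧ |v z| ≤ B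

/-- The time derivative at `x = 0` of a quantity transported by the fluid from the half-line
`x < 0` through three layers, the last of which is bounded by a particle path and contains the
`t`-axis. -/
theorem hasDerivAt_star_of_patches {r T : ℝ} (hr : 0 < r) (hT : 0 < T)
    {r' y₁ y₁' y₂ y₂' y₃ y₃' : ℝ → ℝ} {ρA uA vA ρB uB vB ρC uC vC : ℝ × ℝ → ℝ}
    (A : Patch T (fun _ => -r) r' y₁ y₁' ρA uA vA)
    (B : Patch T y₁ y₁' y₂ y₂' ρB uB vB) (C : Patch T y₂ y₂' y₃ y₃' ρC uC vC)
    (bA : BoundedNear (closedStrip T (fun _ => -r) y₁) ρA uA vA)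
    (bB : BoundedNear (closedStrip T y₁ y₂) ρB uB vB)
    (bC : BoundedNear (closedStrip T y₂ y₃) ρC uC vC)
    (jump₁ : ∀ t ∈ Ioo 0 T, vA (y₁ t, t) = vB (y₁ t, t) ∧
      ρA (y₁ t, t) * (y₁' t - uA (y₁ t, t)) = ρB (y₁ t, t) * (y₁' t - uB (y₁ t, t)))
    (jump₂ : ∀ t ∈ Ioo 0 T, vB (y₂ t, t) = vC (y₂ t, t) ∧
      ρB (y₂ t, t) * (y₂' t - uB (y₂ t, t)) = ρC (y₂ t, t) * (y₂' t - uC (y₂ t, t)))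
    (contact : ∀ t ∈ Ioo 0 T, y₃' t = uC (y₃ t, t))
    (lim₁ : Tendsto y₁ (𝓝[>] 0) (𝓝 0)) (lim₂ : Tendsto y₂ (𝓝[>] 0) (𝓝 0))
    (lim₃ : Tendsto y₃ (𝓝[>] 0) (𝓝 0))
    {ρ₀ d w d₂ j : ℝ} (hρ₀ : 0 < ρ₀)
    (init_rho : ∀ y ∈ Ioo (-r) 0, Tendsto (fun t => ρA (y, t)) (𝓝[>] 0) (𝓝 (ρ₀ + y * d)))
    (init_v : ∀ y ∈ Ioo (-r) 0,
      Tendsto (fun t => vA (y, t)) (𝓝[>] 0) (𝓝 ((w + y * d₂) / (ρ₀ + y * d))))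
    (axis : ∀ᶠ t in 𝓝[>] 0, y₂ t < 0 ∧ 0 < y₃ t)
    (hj : Tendsto (fun t => ρC (0, t) * uC (0, t)) (𝓝[>] 0) (𝓝 j)) :
    ∃ D : ℝ → ℝ, (∀ᶠ t in 𝓝[>] 0, HasDerivAt (fun s => vC (0, s)) (D t) t) ∧
      Tendsto D (𝓝[>] 0)
        (𝓝 (deriv (fun x => (w + x * d₂) / (ρ₀ + x * d)) 0 / ρ₀ * -j)) := by
  obtain ⟨G, η, b₀, CG, hη, hb₀, hG, hGC, hG₀, hG'⟩ := exists_function_of_mass hρ₀ d w d₂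
  obtain ⟨ηA, hηA, BA, bA⟩ := bA
  obtain ⟨ηB, hηB, BB, bB⟩ := bB
  obtain ⟨ηC, hηC, BC, bC⟩ := bC
  set ε := min ηA (min ηB ηC) with hε
  have hε0 : 0 < ε := lt_min hηA (lt_min hηB hηC)
  -- One constant bounds densities, transported quantities and `G`. It also bounds the fluid speed
  -- in the outer layer, so a curve of speed `M` has the required inflow sign.
  set M := max |CG| (max BA (max BB BC)) with hM
  have hM0 : 0 ≤ M := le_max_of_le_left (abs_nonneg _)
  -- The four constraints keep the base interval, respectively, where `G` describes the data, inside
  -- the domain, where the bounds hold, and short enough for the potential to stay in the domain of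
  -- `G`.
  set b := min b₀ (min (r / 2) (min (ε / 2) (η / (2 * (M + 1))))) with hb
  have hb0 : 0 < b := by positivity
  have hbb : b ≤ b₀ := min_le_left _ _
  have hbr : b < r := lt_of_le_of_lt ((min_le_right _ _).trans (min_le_left _ _)) (half_lt_self hr)
  have hbε : b < ε := lt_of_le_of_lt (((min_le_right _ _).trans (min_le_right _ _)).trans
    (min_le_left _ _)) (half_lt_self hε0)
  have hbM : M * b < η := by
    have h1 : b ≤ η / (2 * (M + 1)) :=
      ((min_le_right _ _).trans (min_le_right _ _)).trans (min_le_right _ _)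
    calc M * b ≤ M * (η / (2 * (M + 1))) := by gcongr
      _ < η := by
        rw [← mul_div_assoc, div_lt_iff₀ (by positivity)]
        nlinarith
  set y₀ : ℝ → ℝ := fun t => -b + M * t with hy₀
  have t0 : Tendsto (fun t : ℝ => t) (𝓝[>] 0) (𝓝 0) := tendsto_id.mono_left nhdsWithin_le_nhds
  have lim₀ : Tendsto y₀ (𝓝[>] 0) (𝓝 (-b)) := by
    simpa using tendsto_const_nhds.add (t0.const_mul M)
  have limw : Tendsto (fun t => M * (y₃ t - y₀ t)) (𝓝[>] 0) (𝓝 (M * b)) := by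
    simpa using (lim₃.sub lim₀).const_mul M
  have ev : ∀ᶠ t in 𝓝[>] 0, t < T ∧ t < ε ∧ y₃ t < ε ∧ y₀ t < y₁ t ∧ M * (y₃ t - y₀ t) < η :=
    (t0.eventually (gt_mem_nhds hT)).and <| (t0.eventually (gt_mem_nhds hε0)).and <|
      (lim₃.eventually (gt_mem_nhds hε0)).and <| (lim₀.eventually_lt lim₁ (by simpa using hb0)).and
      (limw.eventually (gt_mem_nhds hbM))
  obtain ⟨δ₀, hδ₀, hδ₀'⟩ := mem_nhdsGT_iff_exists_Ioo_subset.1 ev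
  set δ := min δ₀ T with hδdef
  have hδ : 0 < δ := lt_min hδ₀ hT
  have hδT : δ ≤ T := min_le_right _ _
  have hsm : ∀ t ∈ Ioo 0 δ, t < T ∧ t < ε ∧ y₃ t < ε ∧ y₀ t < y₁ t ∧ M * (y₃ t - y₀ t) < η :=
    fun t ht => hδ₀' ⟨ht.1, ht.2.trans_le (min_le_left _ _)⟩
  have hs : Ioo 0 δ ⊆ Ioo 0 T := Ioo_subset_Ioo_right hδT
  have hy₀b : ∀ t ∈ Ioo 0 δ, -b ≤ y₀ t := fun t ht => by
    have := mul_nonneg hM0 ht.1.le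
    simp only [hy₀]; linarith
  have near : ∀ t ∈ Ioo 0 δ, ∀ x, y₀ t ≤ x → x ≤ y₃ t → |x| < ε ∧ |t| < ε := by
    intro t ht x h1 h2
    have := hy₀b t ht
    obtain ⟨-, h3, h4, -⟩ := hsm t ht
    exact ⟨abs_lt.2 ⟨by linarith, by linarith⟩, by rwa [abs_of_pos ht.1]⟩
  have A' : Patch δ y₀ (fun _ => M) y₁ y₁' ρA uA vA := by
    refine A.restrict hδT ⟨fun t _ => ?_, continuousOn_const⟩ (fun t ht => ?_)
      fun t ht => (hsm t ht).2.2.2.1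
    · exact (((hasDerivAt_id t).const_mul M).const_add (-b)).congr_deriv (mul_one M)
    · have := hy₀b t ht
      linarith
  have B' := B.shorten hδT
  have C' := C.shorten hδT
  have kA : ∀ z ∈ closedStrip δ y₀ y₁, |ρA z| ≤ M ∧ |uA z| ≤ M ∧ |vA z| ≤ M := by
    intro z hz
    have ht : z.2 ∈ Ioo 0 δ := ⟨hz.1, hz.2.1⟩
    obtain ⟨h1, h2⟩ := near z.2 ht z.1 hz.2.2.1
      (hz.2.2.2.trans ((B'.lt _ ht).trans (C'.lt _ ht)).le)
    have h3 := bA z ⟨hz.1, (hs ht).2, by linarith [hy₀b _ ht, hz.2.2.1], hz.2.2.2⟩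
      (h1.trans_le (min_le_left _ _)) (h2.trans_le (min_le_left _ _))
    have h4 : BA ≤ M := (le_max_left _ _).trans (le_max_right _ _)
    exact ⟨h3.1.trans h4, h3.2.1.trans h4, h3.2.2.trans h4⟩
  have kB : ∀ z ∈ closedStrip δ y₁ y₂, |ρB z| ≤ M ∧ |vB z| ≤ M := by
    intro z hz
    have ht : z.2 ∈ Ioo 0 δ := ⟨hz.1, hz.2.1⟩
    obtain ⟨h1, h2⟩ := near z.2 ht z.1 ((A'.lt _ ht).le.trans hz.2.2.1)
      (hz.2.2.2.trans (C'.lt _ ht).le)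
    have h5 : ε ≤ ηB := (min_le_right _ _).trans (min_le_left _ _)
    have h3 := bB z ⟨hz.1, (hs ht).2, hz.2.2⟩ (h1.trans_le h5) (h2.trans_le h5)
    have h4 : BB ≤ M := ((le_max_left _ _).trans (le_max_right _ _)).trans (le_max_right _ _)
    exact ⟨h3.1.trans h4, h3.2.2.trans h4⟩
  have kC : ∀ z ∈ closedStrip δ y₂ y₃, |ρC z| ≤ M ∧ |vC z| ≤ M := by
    intro z hz
    have ht : z.2 ∈ Ioo 0 δ := ⟨hz.1, hz.2.1⟩
    obtain ⟨h1, h2⟩ := near z.2 ht z.1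
      (((A'.lt _ ht).trans (B'.lt _ ht)).le.trans hz.2.2.1) hz.2.2.2
    have h5 : ε ≤ ηC := (min_le_right _ _).trans (min_le_right _ _)
    have h3 := bC z ⟨hz.1, (hs ht).2, hz.2.2⟩ (h1.trans_le h5) (h2.trans_le h5)
    have h4 : BC ≤ M := ((le_max_right _ _).trans (le_max_right _ _)).trans (le_max_right _ _)
    exact ⟨h3.1.trans h4, h3.2.2.trans h4⟩
  have LA : Layer δ M y₀ (fun _ => M) y₁ y₁' ρA uA vA :=
    ⟨A', fun z hz => (le_abs_self _).trans (kA z hz).1, fun z hz => (kA z hz).2.2⟩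
  have LB : Layer δ M y₁ y₁' y₂ y₂' ρB uB vB :=
    ⟨B', fun z hz => (le_abs_self _).trans (kB z hz).1, fun z hz => (kB z hz).2⟩
  have LC : Layer δ M y₂ y₂' y₃ y₃' ρC uC vC :=
    ⟨C', fun z hz => (le_abs_self _).trans (kC z hz).1, fun z hz => (kC z hz).2⟩
  have main : ∀ t ∈ Ioo 0 δ, y₂ t < 0 → 0 < y₃ t → ∃ m, |m| ≤ M * y₃ t ∧
      HasDerivAt (fun s => vC (0, s)) (deriv G m * -(ρC (0, t) * uC (0, t))) t := by
    intro t ht h2 h3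
    have hz : ((0 : ℝ), t) ∈ openStrip δ y₂ y₃ := ⟨ht.1, ht.2, h2, h3⟩
    have := Layer.hasDerivAt_of_initial hδ hb0 LA LB LC (fun t ht => jump₁ t (hs ht))
      (fun t ht => jump₂ t (hs ht)) (fun t ht => contact t (hs ht))
      (fun t ht => (le_abs_self _).trans (kA _ (LA.left_mem ht)).2.1) lim₀ lim₁ lim₂ lim₃
      (ρ₀ := fun y => ρ₀ + y * d) (v₀ := fun y => (w + y * d₂) / (ρ₀ + y * d))
      (fun y hy => init_rho y ⟨by linarith [hy.1], hy.2⟩)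
      (fun y hy => init_v y ⟨by linarith [hy.1], hy.2⟩) hG
      (fun m hm => (hGC m hm).trans ((le_abs_self _).trans (le_max_left _ _)))
      (fun t ht => (hsm t ht).2.2.2.2) (fun y hy => hG₀ y ⟨by linarith [hy.1], hy.2⟩) hz
    simpa using this
  have evm : ∀ᶠ t in 𝓝[>] 0, ∃ m, |m| ≤ M * y₃ t ∧
      HasDerivAt (fun s => vC (0, s)) (deriv G m * -(ρC (0, t) * uC (0, t))) t := by
    filter_upwards [Ioo_mem_nhdsGT hδ, axis] with t ht h
    exact main t ht h.1 h.2
  -- The mass coordinate on the axis is selected as a function of `t`. The bound `|m| ≤ M y₃` sends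
  -- it to `0`, where `deriv G` is continuous.
  obtain ⟨μ, hμ⟩ := evm.choice
  refine ⟨fun t => deriv G (μ t) * -(ρC (0, t) * uC (0, t)), hμ.mono fun t ht => ht.2, ?_⟩
  have hμ0 : Tendsto μ (𝓝[>] 0) (𝓝 0) := by
    refine squeeze_zero_norm' (hμ.mono fun t ht => ht.1) ?_
    simpa using lim₃.const_mul M
  have hc : ContinuousAt (deriv G) 0 :=
    (hG.continuousOn_deriv_of_isOpen isOpen_Ioo le_rfl).continuousAt
      (isOpen_Ioo.mem_nhds ⟨by linarith, hη⟩)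
  rw [← hG', mul_div_cancel_right₀ _ hρ₀.ne']
  exact (hc.tendsto.comp hμ0).mul hj.neg

/-! ### Reflection in `x`. -/

/-- The reflection `(x, t) ↦ (-x, t)`. -/
def reflectX : (ℝ × ℝ) →L[ℝ] ℝ × ℝ :=
  (-ContinuousLinearMap.fst ℝ ℝ ℝ).prod (ContinuousLinearMap.snd ℝ ℝ ℝ)

@[simp]
theorem reflectX_apply (z : ℝ × ℝ) : reflectX z = (-z.1, z.2) := rfl

theorem fderiv_comp_reflectX {h : ℝ × ℝ → ℝ} {z : ℝ × ℝ}
    (hh : DifferentiableAt ℝ h (reflectX z)) :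
    fderiv ℝ (fun z => h (reflectX z)) z = (fderiv ℝ h (reflectX z)).comp reflectX :=
  (hh.hasFDerivAt.comp z reflectX.hasFDerivAt).fderiv

theorem TameOn.reflect {Ω K : Set (ℝ × ℝ)} {h : ℝ × ℝ → ℝ} (hh : TameOn Ω K h)
    (hΩ : IsOpen Ω) : TameOn (reflectX ⁻¹' Ω) (reflectX ⁻¹' K) (fun z => h (reflectX z)) where
  cont := hh.cont.comp reflectX.continuous.continuousOn fun _ hz => hz
  smooth := hh.smooth.comp reflectX.contDiff.contDiffOn fun _ hz => hz
  bdd z hz := by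
    obtain ⟨C, hC⟩ := hh.bdd _ hz
    have h1 : Tendsto reflectX (𝓝[reflectX ⁻¹' Ω] z) (𝓝[Ω] (reflectX z)) :=
      (reflectX.continuous.continuousAt.continuousWithinAt).tendsto_nhdsWithin fun _ hw => hw
    refine ⟨C * ‖reflectX‖, ?_⟩
    filter_upwards [h1.eventually hC, self_mem_nhdsWithin] with w h2 h3
    rw [fderiv_comp_reflectX (hh.differentiableAt hΩ h3)]
    exact (ContinuousLinearMap.opNorm_comp_le _ _).trans (by gcongr)

theorem TameOn.neg {Ω K : Set (ℝ × ℝ)} {h : ℝ × ℝ → ℝ} (hh : TameOn Ω K h) :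
    TameOn Ω K (fun z => -h z) where
  cont := hh.cont.neg
  smooth := hh.smooth.neg
  bdd z hz := by
    obtain ⟨C, hC⟩ := hh.bdd z hz
    refine ⟨C, hC.mono fun w hw => ?_⟩
    rwa [fderiv_fun_neg, norm_neg]

theorem closedStrip_reflect (δ : ℝ) (f g : ℝ → ℝ) :
    closedStrip δ (fun t => -g t) (fun t => -f t) = reflectX ⁻¹' closedStrip δ f g := by
  ext z
  simp only [closedStrip, mem_ofPred_eq, mem_preimage, reflectX_apply]
  constructor <;> rintro ⟨h1, h2, h3, h4⟩ <;> exact ⟨h1, h2, by linarith, by linarith⟩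

theorem openStrip_reflect (δ : ℝ) (f g : ℝ → ℝ) :
    openStrip δ (fun t => -g t) (fun t => -f t) = reflectX ⁻¹' openStrip δ f g := by
  ext z
  simp only [openStrip, mem_ofPred_eq, mem_preimage, reflectX_apply]
  constructor <;> rintro ⟨h1, h2, h3, h4⟩ <;> exact ⟨h1, h2, by linarith, by linarith⟩

theorem IsC1Curve.neg {δ : ℝ} {f f' : ℝ → ℝ} (h : IsC1Curve δ f f') :
    IsC1Curve δ (fun t => -f t) (fun t => -f' t) :=
  ⟨fun t ht => (h.hasDerivAt t ht).neg, h.continuousOn.neg⟩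

/-- Mass conservation and transport are invariant when `x` and `u` change sign together. The two
boundary curves exchange their roles. -/
theorem Patch.reflect {δ : ℝ} {f f' g g' : ℝ → ℝ} {ρ u v : ℝ × ℝ → ℝ}
    (h : Patch δ f f' g g' ρ u v) :
    Patch δ (fun t => -g t) (fun t => -g' t) (fun t => -f t) (fun t => -f' t)
      (fun z => ρ (reflectX z)) (fun z => -u (reflectX z)) (fun z => v (reflectX z)) := by
  have hΩ : IsOpen (openStrip δ f g) :=
    isOpen_openStrip h.left.continuousOn_curve h.right.continuousOn_curve
  have e1 : reflectX (1, 0) = -((1, 0) : ℝ × ℝ) := by ext <;> simp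
  have e2 : reflectX (0, 1) = (0, 1) := by ext <;> simp
  refine ⟨fun t ht => neg_lt_neg (h.lt t ht), h.right.neg, h.left.neg, ?_, ?_, ?_, ?_, ?_, ?_⟩
  · rw [openStrip_reflect, closedStrip_reflect]; exact h.tame_rho.reflect hΩ
  · rw [openStrip_reflect, closedStrip_reflect]; exact (h.tame_u.reflect hΩ).neg
  · rw [openStrip_reflect, closedStrip_reflect]; exact h.tame_v.reflect hΩ
  · rw [closedStrip_reflect]; exact fun z hz => h.pos _ hz
  · rw [openStrip_reflect]
    intro z hz
    have := h.mass _ hz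
    rw [fderiv_fun_neg, fderiv_comp_reflectX (h.tame_rho.differentiableAt hΩ hz),
      fderiv_comp_reflectX (h.tame_u.differentiableAt hΩ hz)]
    simp only [neg_apply, ContinuousLinearMap.comp_apply, e1, e2, map_neg]
    linear_combination this
  · rw [openStrip_reflect]
    intro z hz
    have := h.transport _ hz
    rw [fderiv_comp_reflectX (h.tame_v.differentiableAt hΩ hz)]
    simp only [ContinuousLinearMap.comp_apply, e1, e2, map_neg]
    linear_combination this

theorem BoundedNear.mono {K K' : Set (ℝ × ℝ)} {ρ u v : ℝ × ℝ → ℝ} (h : BoundedNear K ρ u v)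
    (hK : K' ⊆ K) : BoundedNear K' ρ u v := by
  obtain ⟨η, hη, B, hB⟩ := h
  exact ⟨η, hη, B, fun z hz => hB z (hK hz)⟩

theorem BoundedNear.reflect {δ : ℝ} {f g : ℝ → ℝ} {ρ u v : ℝ × ℝ → ℝ}
    (h : BoundedNear (closedStrip δ f g) ρ u v) :
    BoundedNear (closedStrip δ (fun t => -g t) (fun t => -f t))
      (fun z => ρ (reflectX z)) (fun z => -u (reflectX z)) (fun z => v (reflectX z)) := by
  obtain ⟨η, hη, B, hB⟩ := h
  refine ⟨η, hη, B, fun z hz h1 h2 => ?_⟩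
  rw [closedStrip_reflect] at hz
  rw [abs_neg]
  exact hB _ hz (by simpa using h1) h2

/-! ### From smooth pieces of the solution to patches. -/

theorem closedStrip_subset_closedSector {δ T : ℝ} {f g k l : ℝ → ℝ} (hδ : δ ≤ T)
    (hfk : ∀ t ∈ Ioo 0 δ, f t ≤ k t) (hlg : ∀ t ∈ Ioo 0 δ, l t ≤ g t) :
    closedStrip δ k l ⊆ closedSector T f g := fun z hz =>
  have ht : z.2 ∈ Ioo 0 δ := ⟨hz.1, hz.2.1⟩
  ⟨hz.1.le, hz.2.1.trans_le hδ, (hfk _ ht).trans hz.2.2.1, hz.2.2.2.trans (hlg _ ht),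
    fun h => hz.1.ne' (congrArg Prod.snd h)⟩

/-- The inner curves `k`, `l` need not be the boundaries of the piece, so that one smooth region can
be cut into several patches. Only components `0` and `2` of the system are used. -/
theorem SmoothPiece.patch {γ a Cv T : ℝ} {f g : ℝ → ℝ} {W V : ℝ × ℝ → State}
    (h : SmoothPiece γ a Cv T f g W V) {δ : ℝ} (hδ : δ ≤ T) {k k' l l' : ℝ → ℝ}
    (hk : IsC1Curve δ k k') (hl : IsC1Curve δ l l') (hfk : ∀ t ∈ Ioo 0 δ, f t ≤ k t)
    (hkl : ∀ t ∈ Ioo 0 δ, k t < l t) (hlg : ∀ t ∈ Ioo 0 δ, l t ≤ g t) :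
    Patch δ k k' l l' (fun z => V z 0) (fun z => V z 1) (fun z => V z 2) := by
  have hΩ : IsOpen (openStrip δ k l) :=
    isOpen_openStrip hk.continuousOn_curve hl.continuousOn_curve
  have hΩK := openStrip_subset δ k l
  have hK : closedStrip δ k l ⊆ closedSector T f g := closedStrip_subset_closedSector hδ hfk hlg
  have hs : openStrip δ k l ⊆ sector T f g := fun z hz =>
    have ht : z.2 ∈ Ioo 0 δ := ⟨hz.1, hz.2.1⟩
    ⟨hz.1.le, hz.2.1.trans_le hδ, (hfk _ ht).trans_lt hz.2.2.1, hz.2.2.2.trans_le (hlg _ ht)⟩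
  have tame : ∀ i : Fin 4, TameOn (openStrip δ k l) (closedStrip δ k l) (fun z => V z i) :=
    fun i => tameOn_of_contDiffOn hΩ hΩK ((contDiffOn_pi.1 h.regular i).mono hK)
  have pos : ∀ z ∈ closedStrip δ k l, 0 < V z 0 := fun z hz => (h.physical z (hK hz)).1
  have ev1 : ∀ z ∈ openStrip δ k l, ∀ᶠ x in 𝓝 z.1, W (x, z.2) = V (x, z.2) := fun z hz =>
    ((by fun_prop : ContinuousAt (fun x : ℝ => (x, z.2)) z.1).eventually
      (hΩ.mem_nhds hz)).mono fun x hx => h.agree (hs hx)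
  have ev2 : ∀ z ∈ openStrip δ k l, ∀ᶠ t in 𝓝 z.2, W (z.1, t) = V (z.1, t) := fun z hz =>
    ((by fun_prop : ContinuousAt (fun t : ℝ => (z.1, t)) z.2).eventually
      (hΩ.mem_nhds hz)).mono fun x hx => h.agree (hs hx)
  have mass : ∀ z ∈ openStrip δ k l, fderiv ℝ (fun z => V z 0) z (0, 1) +
      (fderiv ℝ (fun z => V z 0) z (1, 0) * V z 1 +
        V z 0 * fderiv ℝ (fun z => V z 1) z (1, 0)) = 0 := by
    intro z hz
    have d0 := (tame 0).differentiableAt hΩ hz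
    have d1 := (tame 1).differentiableAt hΩ hz
    have h1 := h.solves z ⟨hs hz, hz.1⟩ 0
    have h2 : HasDerivAt (fun t => cons a Cv (W (z.1, t)) 0)
        (fderiv ℝ (fun z => V z 0) z (0, 1)) z.2 :=
      (hasDerivAt_slice_snd d0).congr_of_eventuallyEq
        ((ev2 z hz).mono fun t ht => by simp [ht, cons, rho])
    have h3 : HasDerivAt (fun x => flux γ a Cv (W (x, z.2)) 0)
        (fderiv ℝ (fun z => V z 0) z (1, 0) * V z 1 +
          V z 0 * fderiv ℝ (fun z => V z 1) z (1, 0)) z.1 :=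
      ((hasDerivAt_slice_fst d0).mul (hasDerivAt_slice_fst d1)).congr_of_eventuallyEq
        ((ev1 z hz).mono fun t ht => by simp [ht, flux, rho, velX])
    rwa [h2.deriv, h3.deriv] at h1
  refine ⟨hkl, hk, hl, tame 0, tame 1, tame 2, pos, mass, fun z hz => ?_⟩
  have d0 := (tame 0).differentiableAt hΩ hz
  have d1 := (tame 1).differentiableAt hΩ hz
  have d2 := (tame 2).differentiableAt hΩ hz
  have h1 := h.solves z ⟨hs hz, hz.1⟩ 2
  have h2 : HasDerivAt (fun t => cons a Cv (W (z.1, t)) 2) _ z.2 :=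
    ((hasDerivAt_slice_snd d0).mul (hasDerivAt_slice_snd d2)).congr_of_eventuallyEq
      ((ev2 z hz).mono fun t ht => by simp [ht, cons, rho, velY])
  have h3 : HasDerivAt (fun x => flux γ a Cv (W (x, z.2)) 2) _ z.1 :=
    (((hasDerivAt_slice_fst d0).mul (hasDerivAt_slice_fst d1)).mul
      (hasDerivAt_slice_fst d2)).congr_of_eventuallyEq
      ((ev1 z hz).mono fun t ht => by simp [ht, flux, rho, velX, velY])
  rw [h2.deriv, h3.deriv] at h1
  have h4 : V z 0 ≠ 0 := (pos z (hΩK hz)).ne'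
  refine (mul_eq_zero.1 ?_).resolve_left h4
  simp only [Pi.mul_apply, Prod.mk.eta] at h1
  -- Conservation of `ρ v` minus `v` times conservation of mass is `ρ (v_t + u v_x) = 0`.
  linear_combination h1 - V z 2 * mass z hz

theorem boundedNear_of_norm_le {K : Set (ℝ × ℝ)} {V : ℝ × ℝ → State} {B : ℝ}
    (h : ∀ᶠ z in 𝓝[K] 0, ‖V z‖ ≤ B) :
    BoundedNear K (fun z => V z 0) (fun z => V z 1) (fun z => V z 2) := by
  rw [eventually_nhdsWithin_iff, Metric.eventually_nhds_iff] at h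
  obtain ⟨η, hη, h⟩ := h
  refine ⟨η, hη, B, fun z hz h1 h2 => ?_⟩
  have h3 : ‖V z‖ ≤ B := h (by
    rw [dist_zero_right, Prod.norm_def]; exact max_lt h1 h2) hz
  exact ⟨(norm_le_pi_norm (V z) 0).trans h3, (norm_le_pi_norm (V z) 1).trans h3,
    (norm_le_pi_norm (V z) 2).trans h3⟩

theorem boundedNear_of_tendsto {K : Set (ℝ × ℝ)} {V : ℝ × ℝ → State} {U : State}
    (h : Tendsto V (𝓝[K] 0) (𝓝 U)) :
    BoundedNear K (fun z => V z 0) (fun z => V z 1) (fun z => V z 2) :=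
  boundedNear_of_norm_le (h.norm.eventually (eventually_le_nhds (lt_add_one ‖U‖)))

theorem tendsto_curve {T : ℝ} (hT : 0 < T) {f g k : ℝ → ℝ} (hk : Tendsto k (𝓝[>] 0) (𝓝 0))
    (h : ∀ᶠ t in 𝓝[>] 0, f t ≤ k t ∧ k t ≤ g t) :
    Tendsto (fun t => (k t, t)) (𝓝[>] 0) (𝓝[closedSector T f g] 0) := by
  rw [tendsto_nhdsWithin_iff]
  refine ⟨hk.prodMk_nhds (tendsto_id.mono_left nhdsWithin_le_nhds), ?_⟩
  filter_upwards [h, Ioo_mem_nhdsGT hT] with t h1 h2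
  exact ⟨h2.1.le, h2.2, h1.1, h1.2, fun h => h2.1.ne' (congrArg Prod.snd h)⟩

theorem tendsto_zero_of_continuousOn {T : ℝ} (hT : 0 < T) {k : ℝ → ℝ}
    (hk : ContinuousOn k (Ico 0 T)) (h0 : k 0 = 0) : Tendsto k (𝓝[>] 0) (𝓝 0) := by
  have h1 := (hk 0 ⟨le_rfl, hT⟩).mono Ioo_subset_Ico_self
  rwa [ContinuousWithinAt, nhdsWithin_Ioo_eq_nhdsGT hT, h0] at h1

/-- Since `k` need not be known to be differentiable at `0`, strict monotonicity near `0` is used.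
It places the `t`-axis between the wave curves from their limiting speeds. -/
theorem eventually_pos_of_deriv {T c : ℝ} (hT : 0 < T) {k k' : ℝ → ℝ}
    (hk : ContinuousOn k (Ico 0 T)) (h0 : k 0 = 0) (hk' : ∀ t ∈ Ioo 0 T, HasDerivAt k (k' t) t)
    (hc : 0 < c) (hlim : Tendsto k' (𝓝[>] 0) (𝓝 c)) : ∀ᶠ t in 𝓝[>] 0, 0 < k t := by
  obtain ⟨δ, hδ, hδ'⟩ := mem_nhdsGT_iff_exists_Ioo_subset.1
    ((hlim.eventually (lt_mem_nhds hc)).and (Ioo_mem_nhdsGT hT))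
  have hδT : Ico 0 δ ⊆ Ico 0 T := by
    intro t ht
    rcases ht.1.eq_or_lt with h | h
    · exact h ▸ ⟨le_rfl, hT⟩
    · exact ⟨ht.1, (hδ' ⟨h, ht.2⟩).2.2⟩
  have hmono : StrictMonoOn k (Ico 0 δ) := by
    refine strictMonoOn_of_deriv_pos (convex_Ico 0 δ) (hk.mono hδT) fun t ht => ?_
    rw [interior_Ico] at ht
    rw [(hk' t (hδ' ht).2).deriv]
    exact (hδ' ht).1
  filter_upwards [Ioo_mem_nhdsGT hδ] with t ht
  have := hmono ⟨le_rfl, hδ⟩ ⟨ht.1.le, ht.2⟩ ht.1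
  rwa [h0] at this

theorem eventually_neg_of_deriv {T c : ℝ} (hT : 0 < T) {k k' : ℝ → ℝ}
    (hk : ContinuousOn k (Ico 0 T)) (h0 : k 0 = 0) (hk' : ∀ t ∈ Ioo 0 T, HasDerivAt k (k' t) t)
    (hc : c < 0) (hlim : Tendsto k' (𝓝[>] 0) (𝓝 c)) : ∀ᶠ t in 𝓝[>] 0, k t < 0 :=
  (eventually_pos_of_deriv hT hk.neg (by simp [h0]) (fun t ht => (hk' t ht).neg) (neg_pos.2 hc)
    hlim.neg).mono fun _ ht => neg_pos.1 ht

/-! ### Sound speed, shock relations and boundary limits. -/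

section Gas

variable {γ a Cv : ℝ}

theorem continuousAt_sound (ha : 0 ≤ a) (hCv : 0 < Cv) {A : State} (hA : Physical A) :
    ContinuousAt (sound γ a Cv) A := by
  have h1 : 0 < A 0 := hA.1
  have h2 : 0 < A 3 := hA.2
  have c0 : ContinuousAt (fun W : State => W 0) A := (continuous_apply 0).continuousAt
  have c3 : ContinuousAt (fun W : State => W 3) A := (continuous_apply 3).continuousAt
  have h3 : A 0 ≠ 0 := h1.ne'
  have h4 : A 0 * A 3 * (A 0 + 4 * a * A 3 ^ 3 / Cv ^ 4) ≠ 0 := by positivity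
  unfold sound pres rho inten
  refine ContinuousAt.sqrt (ContinuousAt.add (ContinuousAt.div ?_ c0 h3)
    (ContinuousAt.div ?_ ?_ h4)) <;> fun_prop

theorem continuousAt_lam1 (ha : 0 ≤ a) (hCv : 0 < Cv) {A : State} (hA : Physical A) :
    ContinuousAt (lam1 γ a Cv) A :=
  ((continuous_apply 1).continuousAt (x := A)).sub (continuousAt_sound ha hCv hA)

namespace LastShock

variable {s : ℝ} {A B : State}

theorem mass (h : LastShock γ a Cv s A B) :
    rho B * velX B - rho A * velX A = s * (rho B - rho A) := by
  simpa [flux, cons] using congrFun h.jump 0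

theorem massFlux (h : LastShock γ a Cv s A B) :
    rho A * (s - velX A) = rho B * (s - velX B) := by
  linear_combination h.mass

/-- The jump condition for `ρ v` says that mass flux times `v` is continuous, and the mass flux is
nonzero because the shock is faster than the fluid on its left. -/
theorem velY_eq (h : LastShock γ a Cv s A B) (hA : Physical A) : velY A = velY B := by
  have h1 : rho B * velX B * velY B - rho A * velX A * velY A =
      s * (rho B * velY B - rho A * velY A) := by
    simpa [flux, cons] using congrFun h.jump 2
  have h2 : rho A * (s - velX A) ≠ 0 := (mul_pos hA.1 (sub_pos.2 h.lax_mid)).ne'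
  refine mul_left_cancel₀ h2 ?_
  linear_combination h1 - velY B * h.massFlux

/-- If the densities agreed, the mass jump would give equal velocities and the momentum jump equal
total pressures. At fixed density `ptot` is strictly increasing in `e`, so the energies would agree
too. Then both sides have the same `lam4`, against the Lax conditions. -/
theorem rho_ne (hγ : 1 < γ) (ha : 0 ≤ a) (h : LastShock γ a Cv s A B)
    (hA : Physical A) (hB : Physical B) : rho B - rho A ≠ 0 := by
  intro h0
  have hρ : rho B = rho A := sub_eq_zero.1 h0
  have hu : velX B = velX A := by
    have h1 := h.mass
    rw [hρ, sub_self, mul_zero, ← mul_sub] at h1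
    exact sub_eq_zero.1 ((mul_eq_zero.1 h1).resolve_left hA.1.ne')
  have hp : ptot γ a Cv B = ptot γ a Cv A := by
    have h1 : rho B * velX B ^ 2 + ptot γ a Cv B - (rho A * velX A ^ 2 + ptot γ a Cv A) =
        s * (rho B * velX B - rho A * velX A) := by
      simpa [flux, cons] using congrFun h.jump 1
    rw [hρ, hu] at h1
    linarith
  have mono : ∀ A B : State, Physical A → Physical B → rho B = rho A → inten A < inten B →
      ptot γ a Cv A < ptot γ a Cv B := by
    intro A B hA hB hρ he
    unfold ptot pres temp
    rw [hρ]
    have h1 : 0 < (γ - 1) * rho A := mul_pos (by linarith) hA.1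
    have h2 : (inten A / Cv) ^ 4 ≤ (inten B / Cv) ^ 4 := by
      rw [div_pow, div_pow]
      have := hA.2.le
      have h5 : (0 : ℝ) ≤ Cv ^ 4 := by positivity
      gcongr
    have h3 := mul_lt_mul_of_pos_left he h1
    have h4 := mul_le_mul_of_nonneg_left h2 ha
    linarith
  have he : inten B = inten A := by
    rcases lt_trichotomy (inten A) (inten B) with h1 | h1 | h1
    · exact absurd hp (mono A B hA hB hρ h1).ne'
    · exact h1.symm
    · exact absurd hp (mono B A hB hA hρ.symm h1).ne
  have hlam : lam4 γ a Cv B = lam4 γ a Cv A := by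
    unfold lam4 sound pres
    rw [hρ, hu, he]
  exact absurd (h.lax_right.trans h.lax_left) (by rw [hlam]; exact lt_irrefl _)

/-- Expresses the speed continuously through the one-sided states, which makes the shock a `C¹`
curve and lets its speed tend to `σ`. -/
theorem speed_eq (hγ : 1 < γ) (ha : 0 ≤ a) (h : LastShock γ a Cv s A B)
    (hA : Physical A) (hB : Physical B) :
    s = (rho B * velX B - rho A * velX A) / (rho B - rho A) := by
  rw [eq_div_iff (h.rho_ne hγ ha hA hB), h.mass]

end LastShock

theorem IsRiemannSolution.bounded {UL U1 U2 UR : State} {σ : ℝ} {ω : ℝ → State}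
    (h : IsRiemannSolution γ a Cv UL U1 U2 UR σ ω) : ∃ B, ∀ ξ < velX U1, ‖ω ξ‖ ≤ B := by
  obtain ⟨B, hB⟩ := isCompact_Icc.exists_bound_of_continuousOn h.fan_continuous
  refine ⟨max B (max ‖UL‖ ‖U1‖), fun ξ hξ => ?_⟩
  rcases le_total ξ (lam1 γ a Cv UL) with h1 | h1
  · rw [h.eq_L ξ h1]
    exact (le_max_left _ _).trans (le_max_right _ _)
  · rcases le_or_gt (lam1 γ a Cv U1) ξ with h2 | h2
    · rw [h.eq_one ξ ⟨h2, hξ⟩]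
      exact (le_max_right _ _).trans (le_max_right _ _)
    · exact (hB ξ ⟨h1, h2.le⟩).trans (le_max_left _ _)

theorem SmoothPiece.continuousOn_curve {T : ℝ} {f g : ℝ → ℝ} {W V : ℝ × ℝ → State}
    (h : SmoothPiece γ a Cv T f g W V) {k : ℝ → ℝ} (hk : ContinuousOn k (Ioo 0 T))
    (hk' : ∀ t ∈ Ioo 0 T, f t ≤ k t ∧ k t ≤ g t) :
    ContinuousOn (fun t => V (k t, t)) (Ioo 0 T) :=
  h.regular.continuousOn.comp (hk.prodMk continuousOn_id) fun t ht =>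
    ⟨ht.1.le, ht.2, (hk' t ht).1, (hk' t ht).2, fun h => ht.1.ne' (congrArg Prod.snd h)⟩

theorem SmoothPiece.physical_curve {T : ℝ} {f g : ℝ → ℝ} {W V : ℝ × ℝ → State}
    (h : SmoothPiece γ a Cv T f g W V) {x t : ℝ} (ht : t ∈ Ioo 0 T) (h1 : f t ≤ x)
    (h2 : x ≤ g t) : Physical (V (x, t)) :=
  h.physical _ ⟨ht.1.le, ht.2, h1, h2, fun h => ht.1.ne' (congrArg Prod.snd h)⟩

theorem SmoothPiece.tendsto_initial {T : ℝ} (hT : 0 < T) {f g : ℝ → ℝ} {W V : ℝ × ℝ → State}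
    (h : SmoothPiece γ a Cv T f g W V) (hf : ContinuousOn f (Ico 0 T))
    (hg : ContinuousOn g (Ico 0 T)) {y : ℝ} (h1 : f 0 < y) (h2 : y < g 0) (hy : y ≠ 0) :
    Tendsto (fun t => V (y, t)) (𝓝[>] 0) (𝓝 (W (y, 0))) := by
  have hgt : ∀ {k : ℝ → ℝ}, ContinuousOn k (Ico 0 T) → Tendsto k (𝓝[>] 0) (𝓝 (k 0)) := by
    intro k hk
    have h1 := (hk 0 ⟨le_rfl, hT⟩).mono Ioo_subset_Ico_self
    rwa [ContinuousWithinAt, nhdsWithin_Ioo_eq_nhdsGT hT] at h1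
  have hmem : (y, (0 : ℝ)) ∈ closedSector T f g :=
    ⟨le_rfl, hT, h1.le, h2.le, fun h => hy (congrArg Prod.fst h)⟩
  have e : W (y, 0) = V (y, 0) := h.agree ⟨le_rfl, hT, h1, h2⟩
  rw [e]
  refine (h.regular.continuousOn _ hmem).tendsto.comp ?_
  rw [tendsto_nhdsWithin_iff]
  refine ⟨tendsto_const_nhds.prodMk_nhds (tendsto_id.mono_left nhdsWithin_le_nhds), ?_⟩
  filter_upwards [Ioo_mem_nhdsGT hT, (hgt hf).eventually (gt_mem_nhds h1),
    (hgt hg).eventually (lt_mem_nhds h2)] with t h3 h4 h5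
  exact ⟨h3.1.le, h3.2, h4.le, h5.le, fun h => hy (congrArg Prod.fst h)⟩

end Gas

theorem hasTimeDerivStar_of_eventually {W V : ℝ × ℝ → State} {d : ℝ} {D : ℝ → ℝ}
    (hWV : ∀ᶠ t in 𝓝[>] 0, W (0, t) = V (0, t))
    (hD : ∀ᶠ t in 𝓝[>] 0, HasDerivAt (fun s => V (0, s) 2) (D t) t)
    (hlim : Tendsto D (𝓝[>] 0) (𝓝 d)) : HasTimeDerivStar (fun z => velY (W z)) d := by
  have h : ∀ᶠ t in 𝓝[>] 0, HasDerivAt (fun s => velY (W (0, s))) (D t) t := by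
    filter_upwards [hD, eventually_eventually_nhdsWithin.2 hWV, self_mem_nhdsWithin]
      with t h1 h2 h3
    rw [IsOpen.nhdsWithin_eq isOpen_Ioi h3] at h2
    exact h1.congr_of_eventuallyEq (h2.mono fun s hs => by simp [hs, velY])
  exact ⟨h.mono fun t ht => ht.differentiableAt,
    hlim.congr' (h.mono fun t ht => ht.deriv.symm)⟩

theorem tendsto_snd_closedSector {T : ℝ} {f g : ℝ → ℝ} (hf : f 0 = 0) (hg : g 0 = 0) :
    Tendsto Prod.snd (𝓝[closedSector T f g] 0) (𝓝[>] 0) := by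
  rw [tendsto_nhdsWithin_iff]
  refine ⟨continuousAt_snd.continuousWithinAt, ?_⟩
  filter_upwards [self_mem_nhdsWithin] with z hz
  obtain ⟨h1, -, h2, h3, h4⟩ := hz
  refine lt_of_le_of_ne h1 fun h => h4 ?_
  rw [← h] at h2 h3
  rw [hf] at h2
  rw [hg] at h3
  exact Prod.ext (le_antisymm h3 h2) h.symm

theorem slopeY_eq (a Cv : ℝ) (A : State) (d : Fin 4 → ℝ) :
    slopeY a Cv A d =
      deriv (fun x => (rho A * velY A + x * d 2) / (rho A + x * d 0)) 0 := by
  simp [slopeY, cons]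

theorem initial_rho {a Cv y : ℝ} {A B : State} {d : Fin 4 → ℝ}
    (h : cons a Cv A = cons a Cv B + y • d) : A 0 = rho B + y * d 0 := by
  simpa [cons, rho] using congrFun h 0

theorem initial_velY {a Cv y : ℝ} {A B : State} {d : Fin 4 → ℝ}
    (h : cons a Cv A = cons a Cv B + y • d) (hA : Physical A) :
    A 2 = (rho B * velY B + y * d 2) / (rho B + y * d 0) := by
  have h1 : A 0 * A 2 = rho B * velY B + y * d 2 := by
    simpa [cons, rho, velY] using congrFun h 2
  rw [← initial_rho h, eq_div_iff (show A 0 ≠ 0 from hA.1.ne'), ← h1, mul_comm]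

theorem isC1Curve_const (T c : ℝ) : IsC1Curve T (fun _ => c) (fun _ => 0) :=
  ⟨fun t _ => hasDerivAt_const t c, continuousOn_const⟩

/-! ### The two positions of the `t`-axis. -/

section Solution

variable {γ a Cv r T : ℝ} {UL U1 U2 UR : State} {σ : ℝ} {ω : ℝ → State} {dL dR : Fin 4 → ℝ}
  {W : ℝ × ℝ → State} {x₀ x₁ x₂ x₃ : ℝ → ℝ} {VL VF V1 V2 VR : ℝ × ℝ → State}

theorem star_of_pos (ha : 0 ≤ a) (hCv : 0 < Cv)
    (hω : IsRiemannSolution γ a Cv UL U1 U2 UR σ ω) (haxis : lam1 γ a Cv U1 < 0)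
    (hr : 0 < r) (hT : 0 < T)
    (hW : IsGRPSolution γ a Cv r T UL U1 U2 UR ω dL dR W x₀ x₁ x₂ x₃ VL VF V1 V2 VR)
    (hu : 0 < velX U1) :
    Tendsto (fun t => W (0, t)) (𝓝[>] 0) (𝓝 U1) ∧
      HasTimeDerivStar (fun z => velY (W z))
        (-(rho U1 * velX U1 / rho UL) * slopeY a Cv UL dL) := by
  obtain ⟨s0, s1, s2, -⟩ := hW.start
  have l0 := tendsto_zero_of_continuousOn hT hW.continuous₀ s0
  have l1 := tendsto_zero_of_continuousOn hT hW.continuous₁ s1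
  have l2 := tendsto_zero_of_continuousOn hT hW.continuous₂ s2
  have htn : ∀ᶠ t : ℝ in 𝓝[>] 0, t ∈ Ioo 0 T := Ioo_mem_nhdsGT hT
  have o0 : ∀ t ∈ Ioo 0 T, -r < x₀ t := fun t ht => (hW.order t ht).1
  have o1 : ∀ t ∈ Ioo 0 T, x₀ t < x₁ t := fun t ht => (hW.order t ht).2.1
  have o2 : ∀ t ∈ Ioo 0 T, x₁ t < x₂ t := fun t ht => (hW.order t ht).2.2.1
  have c0 : IsC1Curve T x₀ (fun t => lam1 γ a Cv (VF (x₀ t, t))) := by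
    refine ⟨fun t ht => (hW.head t ht).2, fun t ht => ?_⟩
    exact (continuousAt_lam1 ha hCv
      (hW.piece_F.physical_curve ht le_rfl (o1 t ht).le)).comp_continuousWithinAt
      (f := fun t => VF (x₀ t, t)) (hW.piece_F.continuousOn_curve
        (hW.continuous₀.mono Ioo_subset_Ico_self) (fun t ht => ⟨le_rfl, (o1 t ht).le⟩) t ht)
  have c1 : IsC1Curve T x₁ (fun t => lam1 γ a Cv (VF (x₁ t, t))) := by
    refine ⟨fun t ht => (hW.tail t ht).2, fun t ht => ?_⟩
    exact (continuousAt_lam1 ha hCv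
      (hW.piece_F.physical_curve ht (o1 t ht).le le_rfl)).comp_continuousWithinAt
      (f := fun t => VF (x₁ t, t)) (hW.piece_F.continuousOn_curve
        (hW.continuous₁.mono Ioo_subset_Ico_self) (fun t ht => ⟨(o1 t ht).le, le_rfl⟩) t ht)
  have c2 : IsC1Curve T x₂ (fun t => velX (V1 (x₂ t, t))) := by
    refine ⟨fun t ht => (hW.contact t ht).1, ?_⟩
    exact (continuous_apply 1).comp_continuousOn (hW.piece_one.continuousOn_curve
      (hW.continuous₂.mono Ioo_subset_Ico_self) fun t ht => ⟨(o2 t ht).le, le_rfl⟩)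
  have neg1 : ∀ᶠ t in 𝓝[>] 0, x₁ t < 0 := by
    refine eventually_neg_of_deriv hT hW.continuous₁ s1 c1.hasDerivAt haxis ?_
    have h1 : Tendsto (fun t => V1 (x₁ t, t)) (𝓝[>] 0) (𝓝 U1) := hW.limit_one.comp
      (tendsto_curve hT l1 (htn.mono fun t ht => ⟨le_rfl, (o2 t ht).le⟩))
    refine ((continuousAt_lam1 ha hCv hω.physical_one).tendsto.comp h1).congr' ?_
    filter_upwards [htn] with t ht
    rw [(hW.tail t ht).1]
    rfl
  have pos2 : ∀ᶠ t in 𝓝[>] 0, 0 < x₂ t := by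
    refine eventually_pos_of_deriv hT hW.continuous₂ s2 c2.hasDerivAt hu ?_
    have h1 : Tendsto (fun t => V1 (x₂ t, t)) (𝓝[>] 0) (𝓝 U1) := hW.limit_one.comp
      (tendsto_curve hT l2 (htn.mono fun t ht => ⟨(o2 t ht).le, le_rfl⟩))
    exact ((continuous_apply 1).tendsto U1).comp h1
  have bF : ∀ᶠ z in 𝓝[closedSector T x₀ x₁] 0, ‖VF z‖ ≤ hω.bounded.choose + 1 := by
    have h1 := hW.limit_F.norm
    rw [norm_zero] at h1
    filter_upwards [h1.eventually (gt_mem_nhds one_pos), self_mem_nhdsWithin,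
      (tendsto_snd_closedSector s0 s1).eventually neg1,
      (tendsto_snd_closedSector s0 s1).eventually self_mem_nhdsWithin] with z h2 h3 h4 h5
    -- Nothing is assumed about `ω` at the contact speed itself, so boundedness of `ω` is used
    -- strictly below it. The fan lies in `x < 0` for small `t`, hence `ξ < 0 < u_*`.
    have h6 : z.1 / z.2 < velX U1 :=
      (div_neg_of_neg_of_pos (h3.2.2.2.1.trans_lt h4) h5).trans hu
    have h7 := hω.bounded.choose_spec _ h6
    calc ‖VF z‖ = ‖ω (z.1 / z.2) + (VF z - ω (z.1 / z.2))‖ := by rw [add_sub_cancel]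
      _ ≤ _ := (norm_add_le _ _).trans (add_le_add h7 h2.le)
  have lim_axis : Tendsto (fun t => V1 (0, t)) (𝓝[>] 0) (𝓝 U1) := by
    refine hW.limit_one.comp (tendsto_curve hT tendsto_const_nhds ?_)
    filter_upwards [neg1, pos2] with t h1 h2 using ⟨h1.le, h2.le⟩
  have hWV : ∀ᶠ t in 𝓝[>] 0, W (0, t) = V1 (0, t) := by
    filter_upwards [neg1, pos2, htn] with t h1 h2 h3
    exact hW.piece_one.agree ⟨h3.1.le, h3.2, h1, h2⟩
  have init : ∀ y ∈ Ioo (-r) 0, Tendsto (fun t => VL (y, t)) (𝓝[>] 0) (𝓝 (W (y, 0))) :=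
    fun y hy => hW.piece_L.tendsto_initial hT continuousOn_const hW.continuous₀ hy.1
      (by rw [s0]; exact hy.2) hy.2.ne
  have phys : ∀ y ∈ Ioo (-r) 0, Physical (W (y, 0)) := fun y hy => by
    rw [hW.piece_L.agree ⟨le_rfl, hT, hy.1, by rw [s0]; exact hy.2⟩]
    exact hW.piece_L.physical _ ⟨le_rfl, hT, hy.1.le, by rw [s0]; exact hy.2.le,
      fun h => hy.2.ne (congrArg Prod.fst h)⟩
  have sub : ∀ f g, closedStrip T f g ⊆ closedSector T f g := fun f g =>
    closedStrip_subset_closedSector le_rfl (fun _ _ => le_rfl) fun _ _ => le_rfl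
  obtain ⟨D, hD, hlim⟩ := hasDerivAt_star_of_patches hr hT
    (hW.piece_L.patch le_rfl (isC1Curve_const T (-r)) c0 (fun _ _ => le_rfl) o0 fun _ _ => le_rfl)
    (hW.piece_F.patch le_rfl c0 c1 (fun _ _ => le_rfl) o1 fun _ _ => le_rfl)
    (hW.piece_one.patch le_rfl c1 c2 (fun _ _ => le_rfl) o2 fun _ _ => le_rfl)
    ((boundedNear_of_tendsto hW.limit_L).mono (sub _ _))
    ((boundedNear_of_norm_le bF).mono (sub _ _))
    ((boundedNear_of_tendsto hW.limit_one).mono (sub _ _))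
    (fun t ht => by simp only [(hW.head t ht).1, and_self])
    (fun t ht => by simp only [(hW.tail t ht).1, and_self])
    (fun t ht => rfl) l0 l1 l2 hω.physical_L.1
    (fun y hy => by
      rw [← initial_rho (hW.init_L y hy)]
      exact ((continuous_apply 0).tendsto (W (y, 0))).comp (init y hy))
    (fun y hy => by
      rw [← initial_velY (hW.init_L y hy) (phys y hy)]
      exact ((continuous_apply 2).tendsto (W (y, 0))).comp (init y hy))
    (neg1.and pos2)
    ((((continuous_apply 0).tendsto U1).comp lim_axis).mul
      (((continuous_apply 1).tendsto U1).comp lim_axis))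
  refine ⟨lim_axis.congr' (hWV.mono fun t ht => ht.symm),
    hasTimeDerivStar_of_eventually hWV hD ?_⟩
  convert hlim using 2
  rw [slopeY_eq]
  simp only [rho, velX]
  ring

theorem star_of_neg (hγ : 1 < γ) (ha : 0 ≤ a)
    (hω : IsRiemannSolution γ a Cv UL U1 U2 UR σ ω) (hσ : 0 < σ)
    (hr : 0 < r) (hT : 0 < T)
    (hW : IsGRPSolution γ a Cv r T UL U1 U2 UR ω dL dR W x₀ x₁ x₂ x₃ VL VF V1 V2 VR)
    (hu : velX U2 < 0) :
    Tendsto (fun t => W (0, t)) (𝓝[>] 0) (𝓝 U2) ∧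
      HasTimeDerivStar (fun z => velY (W z))
        (-(velX U2 * (σ - velX UR) / (σ - velX U2)) * slopeY a Cv UR dR) := by
  obtain ⟨-, -, s2, s3⟩ := hW.start
  have l2 := tendsto_zero_of_continuousOn hT hW.continuous₂ s2
  have l3 := tendsto_zero_of_continuousOn hT hW.continuous₃ s3
  have lt : Tendsto (fun t : ℝ => t) (𝓝[>] 0) (𝓝 0) := tendsto_id.mono_left nhdsWithin_le_nhds
  -- The artificial curve `x₃ t + t` splits the region right of the shock in two. This side then
  -- also has three layers, with trivial jump conditions at the extra curve.
  have l4 : Tendsto (fun t => x₃ t + t) (𝓝[>] 0) (𝓝 0) := by simpa using l3.add lt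
  have htn : ∀ᶠ t : ℝ in 𝓝[>] 0, t ∈ Ioo 0 T := Ioo_mem_nhdsGT hT
  have o2 : ∀ t ∈ Ioo 0 T, x₂ t < x₃ t := fun t ht => (hW.order t ht).2.2.2.1
  have o3 : ∀ t ∈ Ioo 0 T, x₃ t < r := fun t ht => (hW.order t ht).2.2.2.2
  have cx3 := hW.continuous₃.mono Ioo_subset_Ico_self
  have p2 : ∀ t ∈ Ioo 0 T, Physical (V2 (x₃ t, t)) := fun t ht =>
    hW.piece_two.physical_curve ht (o2 t ht).le le_rfl
  have pR : ∀ t ∈ Ioo 0 T, Physical (VR (x₃ t, t)) := fun t ht =>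
    hW.piece_R.physical_curve ht le_rfl (o3 t ht).le
  have k2 := hW.piece_two.continuousOn_curve cx3 fun t ht => ⟨(o2 t ht).le, le_rfl⟩
  have kR := hW.piece_R.continuousOn_curve cx3 fun t ht => ⟨le_rfl, (o3 t ht).le⟩
  have lim2 : Tendsto (fun t => V2 (x₃ t, t)) (𝓝[>] 0) (𝓝 U2) := hW.limit_two.comp
    (tendsto_curve hT l3 (htn.mono fun t ht => ⟨(o2 t ht).le, le_rfl⟩))
  have limR : Tendsto (fun t => VR (x₃ t, t)) (𝓝[>] 0) (𝓝 UR) := hW.limit_R.comp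
    (tendsto_curve hT l3 (htn.mono fun t ht => ⟨le_rfl, (o3 t ht).le⟩))
  set s : ℝ → ℝ := fun t => (rho (VR (x₃ t, t)) * velX (VR (x₃ t, t)) -
    rho (V2 (x₃ t, t)) * velX (V2 (x₃ t, t))) / (rho (VR (x₃ t, t)) - rho (V2 (x₃ t, t))) with hs
  have hshock : ∀ t ∈ Ioo 0 T, HasDerivAt x₃ (s t) t ∧
      LastShock γ a Cv (s t) (V2 (x₃ t, t)) (VR (x₃ t, t)) := by
    intro t ht
    obtain ⟨q, hq, hsh⟩ := hW.shock t ht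
    have h1 : s t = q := (hsh.speed_eq hγ ha (p2 t ht) (pR t ht)).symm
    rw [h1]
    exact ⟨hq, hsh⟩
  have crho : Continuous rho := continuous_apply 0
  have cvel : Continuous velX := continuous_apply 1
  have cs : ContinuousOn s (Ioo 0 T) := by
    refine ContinuousOn.div ?_ ?_ fun t ht =>
      (hshock t ht).2.rho_ne hγ ha (p2 t ht) (pR t ht)
    · exact ((crho.comp_continuousOn kR).mul (cvel.comp_continuousOn kR)).sub
        ((crho.comp_continuousOn k2).mul (cvel.comp_continuousOn k2))
    · exact (crho.comp_continuousOn kR).sub (crho.comp_continuousOn k2)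
  have lims : Tendsto s (𝓝[>] 0) (𝓝 σ) := by
    rw [hω.shock.speed_eq hγ ha hω.physical_two hω.physical_R]
    have r2 := (crho.tendsto U2).comp lim2
    have rR := (crho.tendsto UR).comp limR
    exact ((rR.mul ((cvel.tendsto UR).comp limR)).sub
      (r2.mul ((cvel.tendsto U2).comp lim2))).div (rR.sub r2)
      (hω.shock.rho_ne hγ ha hω.physical_two hω.physical_R)
  have neg2 : ∀ᶠ t in 𝓝[>] 0, x₂ t < 0 := by
    refine eventually_neg_of_deriv hT hW.continuous₂ s2 (fun t ht => (hW.contact t ht).1) hu ?_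
    have h1 : Tendsto (fun t => V2 (x₂ t, t)) (𝓝[>] 0) (𝓝 U2) := hW.limit_two.comp
      (tendsto_curve hT l2 (htn.mono fun t ht => ⟨le_rfl, (o2 t ht).le⟩))
    refine ((cvel.tendsto U2).comp h1).congr' ?_
    filter_upwards [htn] with t ht using (hW.contact t ht).2.1.symm
  have pos3 : ∀ᶠ t in 𝓝[>] 0, 0 < x₃ t :=
    eventually_pos_of_deriv hT hW.continuous₃ s3 (fun t ht => (hshock t ht).1) hσ lims
  have lim_axis : Tendsto (fun t => V2 (0, t)) (𝓝[>] 0) (𝓝 U2) := by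
    refine hW.limit_two.comp (tendsto_curve hT tendsto_const_nhds ?_)
    filter_upwards [neg2, pos3] with t h1 h2 using ⟨h1.le, h2.le⟩
  have hWV : ∀ᶠ t in 𝓝[>] 0, W (0, t) = V2 (0, t) := by
    filter_upwards [neg2, pos3, htn] with t h1 h2 h3
    exact hW.piece_two.agree ⟨h3.1.le, h3.2, h1, h2⟩
  obtain ⟨δ₀, hδ₀, hδ₀'⟩ := mem_nhdsGT_iff_exists_Ioo_subset.1
    (l4.eventually (gt_mem_nhds hr))
  set δ := min δ₀ T with hδdef
  have hδ : 0 < δ := lt_min hδ₀ hT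
  have hδT : δ ≤ T := min_le_right _ _
  have hsub : Ioo 0 δ ⊆ Ioo 0 T := Ioo_subset_Ioo_right hδT
  have o4 : ∀ t ∈ Ioo 0 δ, x₃ t + t < r := fun t ht =>
    hδ₀' ⟨ht.1, ht.2.trans_le (min_le_left _ _)⟩
  have o5 : ∀ t ∈ Ioo 0 δ, x₃ t < x₃ t + t := fun t ht => lt_add_of_pos_right _ ht.1
  have c2 : IsC1Curve δ x₂ (fun t => velX (V2 (x₂ t, t))) := by
    refine ⟨fun t ht => ?_, ?_⟩
    · rw [← (hW.contact t (hsub ht)).2.1]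
      exact (hW.contact t (hsub ht)).1
    · exact cvel.comp_continuousOn ((hW.piece_two.continuousOn_curve
        (hW.continuous₂.mono Ioo_subset_Ico_self)
        fun t ht => ⟨le_rfl, (o2 t ht).le⟩).mono hsub)
  have c3 : IsC1Curve δ x₃ s := ⟨fun t ht => (hshock t (hsub ht)).1, cs.mono hsub⟩
  have c4 : IsC1Curve δ (fun t => x₃ t + t) (fun t => s t + 1) :=
    ⟨fun t ht => (c3.hasDerivAt t ht).add (hasDerivAt_id t), c3.continuousOn.add continuousOn_const⟩
  have init : ∀ y ∈ Ioo 0 r, Tendsto (fun t => VR (y, t)) (𝓝[>] 0) (𝓝 (W (y, 0))) :=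
    fun y hy => hW.piece_R.tendsto_initial hT hW.continuous₃ continuousOn_const
      (by rw [s3]; exact hy.1) hy.2 hy.1.ne'
  have phys : ∀ y ∈ Ioo 0 r, Physical (W (y, 0)) := fun y hy => by
    rw [hW.piece_R.agree ⟨le_rfl, hT, by rw [s3]; exact hy.1, hy.2⟩]
    exact hW.piece_R.physical _ ⟨le_rfl, hT, by rw [s3]; exact hy.1.le, hy.2.le,
      fun h => hy.1.ne' (congrArg Prod.fst h)⟩
  have hneg : ∀ y ∈ Ioo (-r) 0, -y ∈ Ioo 0 r := fun y hy =>
    ⟨neg_pos.2 hy.2, neg_lt.1 hy.1⟩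
  have bR := boundedNear_of_tendsto hW.limit_R
  obtain ⟨D, hD, hlim⟩ := hasDerivAt_star_of_patches hr hδ
    (hW.piece_R.patch hδT c4 (isC1Curve_const δ r) (fun t ht => (o5 t ht).le) o4
      fun _ _ => le_rfl).reflect
    (hW.piece_R.patch hδT c3 c4 (fun _ _ => le_rfl) o5 fun t ht => (o4 t ht).le).reflect
    (hW.piece_two.patch hδT c2 c3 (fun _ _ => le_rfl) (fun t ht => o2 t (hsub ht))
      fun _ _ => le_rfl).reflect
    (bR.mono (closedStrip_subset_closedSector hδT (fun t ht => (o5 t ht).le)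
      fun _ _ => le_rfl)).reflect
    (bR.mono (closedStrip_subset_closedSector hδT (fun _ _ => le_rfl)
      fun t ht => (o4 t ht).le)).reflect
    ((boundedNear_of_tendsto hW.limit_two).mono (closedStrip_subset_closedSector hδT
      (fun _ _ => le_rfl) fun _ _ => le_rfl)).reflect
    (fun t ht => ⟨rfl, rfl⟩)
    (fun t ht => by
      have h1 := (hshock t (hsub ht)).2
      have h2 := h1.massFlux
      have h3 := h1.velY_eq (p2 t (hsub ht))
      simp only [rho, velX, velY] at h2 h3
      simp only [reflectX_apply, neg_neg]
      exact ⟨h3.symm, by linear_combination h2⟩)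
    (fun t ht => by simp only [reflectX_apply, neg_neg]; rfl)
    (by simpa using l4.neg) (by simpa using l3.neg) (by simpa using l2.neg) hω.physical_R.1
    (d := -dR 0) (w := rho UR * velY UR) (d₂ := -dR 2)
    (fun y hy => by
      have h1 := initial_rho (hW.init_R (-y) (hneg y hy))
      rw [show rho UR + y * -dR 0 = W (-y, 0) 0 by rw [h1]; ring]
      exact ((continuous_apply 0).tendsto (W (-y, 0))).comp (init (-y) (hneg y hy)))
    (fun y hy => by
      have h1 := initial_velY (hW.init_R (-y) (hneg y hy)) (phys (-y) (hneg y hy))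
      rw [show (rho UR * velY UR + y * -dR 2) / (rho UR + y * -dR 0) = W (-y, 0) 2 by
        rw [h1]; congr 1 <;> ring]
      exact ((continuous_apply 2).tendsto (W (-y, 0))).comp (init (-y) (hneg y hy)))
    (by filter_upwards [neg2, pos3] with t h1 h2 using ⟨by linarith, by linarith⟩)
    (j := rho U2 * -velX U2)
    (by
      simp only [reflectX_apply, neg_zero]
      exact ((crho.tendsto U2).comp lim_axis).mul ((cvel.tendsto U2).comp lim_axis).neg)
  refine ⟨lim_axis.congr' (hWV.mono fun t ht => ht.symm),
    hasTimeDerivStar_of_eventually hWV (D := D) (by simpa using hD) ?_⟩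
  convert hlim using 2
  have hslope : deriv (fun x => (rho UR * velY UR + x * -dR 2) / (rho UR + x * -dR 0)) 0 =
      -slopeY a Cv UR dR := by
    have h1 := deriv_comp_neg
      (fun x => (rho UR * velY UR + x * dR 2) / (rho UR + x * dR 0)) (0 : ℝ)
    rw [neg_zero, ← slopeY_eq a Cv UR dR] at h1
    rw [← h1]
    congr 1
    ext x
    ring_nf
  rw [hslope]
  have h1 : σ - velX U2 ≠ 0 := (sub_pos.2 hω.shock.lax_mid).ne'
  have h2 : rho UR ≠ 0 := hω.physical_R.1.ne'
  field_simp
  -- Reflection reverses both the slope and the velocity. What remains is to replace the ratio of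
  -- the densities of `U2` and `UR` by `(σ - u_R) / (σ - u_*)`, which is continuity of the mass flux
  -- at the shock.
  linear_combination velX U2 * slopeY a Cv UR dR * hω.shock.massFlux

end Solution

end RHE

theorem mainTheorem10 (γ a Cv : ℝ) (hγ : 1 < γ) (ha : 0 ≤ a) (hCv : 0 < Cv)
    (UL U1 U2 UR : RHE.State) (σ : ℝ) (ω : ℝ → RHE.State)
    (hω : RHE.IsRiemannSolution γ a Cv UL U1 U2 UR σ ω)
    (haxis : RHE.lam1 γ a Cv U1 < 0 ∧ 0 < σ)
    (r T : ℝ) (hr : 0 < r) (hT : 0 < T) (dL dR : Fin 4 → ℝ)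
    (W : ℝ × ℝ → RHE.State) (x₀ x₁ x₂ x₃ : ℝ → ℝ) (VL VF V1 V2 VR : ℝ × ℝ → RHE.State)
    (hW : RHE.IsGRPSolution γ a Cv r T UL U1 U2 UR ω dL dR W x₀ x₁ x₂ x₃ VL VF V1 V2 VR) :
    (0 < RHE.velX U1 →
      Tendsto (fun t => W (0, t)) (𝓝[>] 0) (𝓝 U1) ∧
      RHE.HasTimeDerivStar (fun z => RHE.velY (W z))
        (-(RHE.rho U1 * RHE.velX U1 / RHE.rho UL) * RHE.slopeY a Cv UL dL)) ∧
    (RHE.velX U2 < 0 →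
      Tendsto (fun t => W (0, t)) (𝓝[>] 0) (𝓝 U2) ∧
      RHE.HasTimeDerivStar (fun z => RHE.velY (W z))
        (-(RHE.velX U2 * (σ - RHE.velX UR) / (σ - RHE.velX U2)) * RHE.slopeY a Cv UR dR)) :=
  ⟨RHE.star_of_pos ha hCv hω haxis.1 hr hT hW, RHE.star_of_neg hγ ha hω haxis.2 hr hT hW⟩
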